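/- Let $M$ be a smooth manifold of dimension $2n$ with a locally conformally symplectic structure: a nondegenerate smooth 2-form $\omega$ and a closed 1-form $\theta$ with $d\omega=-\omega\wedge\theta$. For $k\in\mathbb Z$ let $d_k\alpha=d\alpha+k\,\theta\wedge\alpha$ on $\Omega^*(M)$, let $H^j_k$ be the $j$-th (Lichnerowicz–Novikov) cohomology of $(\Omega^*(M),d_k)$ (with $\Omega^{-1}(M)=0$ and $H^{-1}_k=0$), and let $L\alpha=\omega\wedge\alpha$, so that $d_kL=Ld_{k-1}$. Let $F^p\Omega^m=L^p\Omega^{m-2p}(M)$ (zero if $m<2p$); this is a filtration stable under $d_k$. Put $E^{p,q}_{k,0}=F^p\Omega^{p+q}/F^{p+1}\Omega^{p+q}$ with the differential $d_{k,0}:E^{p,q}_{k,0}\to E^{p,q+1}_{k,0}$ induced by $d_k$, and let $E^{p,q}_{k,1}$ be its cohomology at $E^{p,q}_{k,0}$, i.e. the $E_1$-term of the spectral sequence of the filtered complex $(F^*\Omega^*,d_k)$. Let $\mathcal P^k\subset\Omega^k(M)$ be the space of primitive forms: $\mathcal P^k=\ker L^{n-k+1}$ if $k\le n$, and $\mathcal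 P^k=0$ if $k>n$. Then, for every $l\in\mathbb Z$: (1) $\Omega^k(M)=\mathcal P^k\oplus L\Omega^{k-2}(M)$ for $0\le k\le n$. Let $\Pi_{pr}:\Omega^k(M)\to\mathcal P^k$ be the corresponding projection (zero if $k>n$), and let $d_l^+=\Pi_{pr}d_l:\mathcal P^k\to\mathcal P^{k+1}$. (2) For $0\le p\le q\le n-1$, the assignment $[a]\mapsto[L^pa]$ ($a\in\mathcal P^{q-p}$, $d_l^+a=0$) is a well-defined linear isomorphism $H^{q-p}(\mathcal P^*,d_l^+)\cong E^{p,q}_{l+p,1}$. (3) For $0\le p\le q\le n-1$ the sequence $$\cdots\to H^{q-p}_l\xrightarrow{\bar L^p}E^{p,q}_{l+p,1}\xrightarrow{\delta_{p,q}}H^{q-p-1}_{l-1}\xrightarrow{\bar L}H^{q-p+1}_l\xrightarrow{\bar L^p}E^{p,q+1}_{l+p,1}\to\cdots$$ is exact, where $\bar L[\eta]=[L\eta]$, $\bar L^p[\beta]=[L^p\beta]$ and $\delta_{p,q}$ is the connecting homomorphism: every cocycle of $E^{p,q}_{l+p,0}$ is of the form $[L^p\alpha]$ with $\alpha\in\Omega^{q-p}(M)$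 and $d_l\alpha=L\eta$ for some $d_{l-1}$-closed $\eta\in\Omega^{q-p-1}(M)$, and $\delta_{p,q}$ sends its class to $[\eta]$ for every such choice. For fixed $p\le n-1$ the sequence begins, at $q=p$, with $0\to H^0_l\to E^{p,p}_{l+p,1}\to0\to H^1_l\to E^{p,p+1}_{l+p,1}\to\cdots$, and exactness is asserted at every term up to and including $H^{n-p}_l$, which is followed by $E^{p,n}_{l+p,1}$. -/

import Mathlib

open scoped Manifold ContDiff Topology

set_option maxSynthPendingDepth 3

noncomputable section

namespace LCS

section

open ContinuousAlternatingMap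
section
variable {E : Type*} [NormedAddCommGroup E] [NormedSpace ℝ E] {k : ℕ}

/-- Alternating `k`-forms on a normed space. -/
abbrev Alt (E : Type*) [NormedAddCommGroup E] [NormedSpace ℝ E] (k : ℕ) : Type _ :=
  E [⋀^Fin k]→L[ℝ] ℝ

/-- A `1`-form as a linear functional. -/
def oneForm (θ : Alt E 1) : E →L[ℝ] ℝ := (ofSubsingletonLIE (𝕜 := ℝ) (E := E) (F := ℝ) (0 : Fin 1)).symm θ

/-- The wedge product `θ ∧ α` of a `1`-form and a `k`-form (see `wedgeOne_apply`). -/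
def wedgeOne (θ : Alt E 1) (α : Alt E k) : Alt E (k + 1) :=
  alternatizeUncurryFin ((oneForm θ).smulRight α)

/-- The wedge product `σ ∧ α` of a `2`-form and a `k`-form, obtained by alternating
`(u, v) ↦ σ(u, v) α`. The explicit formula as a sum over `(2, k)`-shuffles is `wedgeTwo_apply`. -/
def wedgeTwo (σ : Alt E 2) (α : Alt E k) : Alt E (k + 2) :=
  (2⁻¹ : ℝ) • alternatizeUncurryFin (alternatizeUncurryFinCLM ℝ E ℝ ∘L
    ((ContinuousLinearMap.smulRightL ℝ E (Alt E k)).flip α ∘L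
      ((ofSubsingletonLIE (𝕜 := ℝ) (E := E) (F := ℝ) (0 : Fin 1)).symm : Alt E 1 →L[ℝ] E →L[ℝ] ℝ) ∘L σ.curryLeft))

theorem oneForm_apply (θ : Alt E 1) (v : E) : oneForm θ v = θ ![v] := by
  simp only [oneForm]
  show θ _ = _
  congr 1; ext i; fin_cases i; rfl

theorem wedgeOne_apply (θ : Alt E 1) (α : Alt E k) (v : Fin (k + 1) → E) :
    wedgeOne θ α v = ∑ i : Fin (k + 1), (-1) ^ (i : ℕ) * (θ ![v i] * α (i.removeNth v)) := by
  simp [wedgeOne, alternatizeUncurryFin_apply, oneForm_apply]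

theorem wedgeTwo_eq (σ : Alt E 2) (α : Alt E k) :
    wedgeTwo σ α = (2⁻¹ : ℝ) • alternatizeUncurryFin (alternatizeUncurryFinCLM ℝ E ℝ ∘L
    ((ContinuousLinearMap.smulRightL ℝ E (Alt E k)).flip α ∘L
      ((ofSubsingletonLIE (𝕜 := ℝ) (E := E) (F := ℝ) (0 : Fin 1)).symm : Alt E 1 →L[ℝ] E →L[ℝ] ℝ) ∘L σ.curryLeft)) := rfl

theorem wedgeTwo_apply (σ : Alt E 2) (α : Alt E k) (v : Fin (k + 2) → E) :
    wedgeTwo σ α v = ∑ i : Fin (k + 1), ∑ j ≥ i,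
      (-1) ^ (i + j : ℕ) * (σ ![v i.castSucc, v j.succ] *
        α (j.removeNth (i.castSucc.removeNth v))) := by
  have h : ∀ x y, σ ![x, y] = - σ ![y, x] := by
    intro x y
    have h0 : σ (![y, x] ∘ Equiv.swap (0 : Fin 2) 1) = - σ ![y, x] :=
      σ.toAlternatingMap.map_swap ![y, x] (i := 0) (j := 1) (by decide)
    rw [← h0]; congr 1; ext i; fin_cases i <;> rfl
  have h1 : ∀ x y, (ofSubsingletonLIE (𝕜 := ℝ) (E := E) (F := ℝ) (0 : Fin 1)).symm (σ.curryLeft x) y = σ ![x, y] := by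
    intro x y
    exact (oneForm_apply (σ.curryLeft x) y)
  simp only [wedgeTwo, ContinuousAlternatingMap.smul_apply,
    alternatizeUncurryFin_alternatizeUncurryFinCLM_comp_apply, Finset.smul_sum]
  refine Finset.sum_congr rfl fun i _ => Finset.sum_congr rfl fun j _ => ?_
  have h2 : ∀ x y, ((ContinuousLinearMap.smulRightL ℝ E (Alt E k)).flip α ∘L
      ((ofSubsingletonLIE (𝕜 := ℝ) (E := E) (F := ℝ) (0 : Fin 1)).symm : Alt E 1 →L[ℝ] E →L[ℝ] ℝ)
        ∘L σ.curryLeft) x y = σ ![x, y] • α := by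
    intro x y
    rw [← h1]; rfl
  rw [h2, h2, h (v j.succ)]
  simp only [ContinuousAlternatingMap.smul_apply, smul_eq_mul, zsmul_eq_mul, Int.cast_pow,
    Int.cast_neg, Int.cast_one]
  ring

theorem swap_alt (B : E →L[ℝ] E →L[ℝ] Alt E k) :
    alternatizeUncurryFin (alternatizeUncurryFinCLM ℝ E ℝ ∘L B.flip) =
    - alternatizeUncurryFin (alternatizeUncurryFinCLM ℝ E ℝ ∘L B) := by
  have := alternatizeUncurryFin_alternatizeUncurryFinCLM_comp_of_symmetric
    (f := B.flip + B) (by intro x y; simp [add_comm])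
  rw [ContinuousLinearMap.comp_add, alternatizeUncurryFin_add] at this
  exact eq_neg_of_add_eq_zero_left this

theorem alt_smulRight_swap (θ : E →L[ℝ] ℝ) (A : E →L[ℝ] Alt E k) :
    alternatizeUncurryFin (alternatizeUncurryFinCLM ℝ E ℝ ∘L
      (ContinuousLinearMap.smulRightL ℝ E (Alt E k) θ ∘L A)) =
    - alternatizeUncurryFin (θ.smulRight (alternatizeUncurryFin A)) := by
  rw [eq_neg_iff_add_eq_zero, ← neg_eq_iff_add_eq_zero, ← swap_alt]
  congr 1
  ext x : 1
  simp only [ContinuousLinearMap.comp_apply, alternatizeUncurryFinCLM_apply,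
    ContinuousLinearMap.smulRight_apply]
  have : (ContinuousLinearMap.smulRightL ℝ E (Alt E k) θ ∘L A).flip x = θ x • A := by
    ext y : 1; simp
  rw [this, alternatizeUncurryFin_smul]

/-- If `W u = σ ∧ A u`, then the alternation of `W` is `σ ∧ (alternation of A)`. -/
theorem wedgeTwo_alt (σ : Alt E 2) (A : E →L[ℝ] Alt E k) (W : E →L[ℝ] Alt E (k + 2))
    (hW : ∀ u, W u = wedgeTwo σ (A u)) :
    alternatizeUncurryFin W = wedgeTwo σ (alternatizeUncurryFin A) := by
  set o : E →L[ℝ] E →L[ℝ] ℝ :=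
    ((ofSubsingletonLIE (𝕜 := ℝ) (E := E) (F := ℝ) (0 : Fin 1)).symm : Alt E 1 →L[ℝ] E →L[ℝ] ℝ) ∘L σ.curryLeft with ho
  let B : E →L[ℝ] E →L[ℝ] Alt E (k + 1) :=
    (ContinuousLinearMap.compL ℝ E (E →L[ℝ] Alt E k) (Alt E (k+1)) (alternatizeUncurryFinCLM ℝ E ℝ))
      ∘L ((ContinuousLinearMap.compL ℝ E (E →L[ℝ] ℝ) (E →L[ℝ] Alt E k)).flip o) ∘L
      (ContinuousLinearMap.smulRightL ℝ E (Alt E k)).flip ∘L A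
  have hW' : W = (2⁻¹ : ℝ) • (alternatizeUncurryFinCLM ℝ E ℝ ∘L B) := by
    ext u : 1
    rw [hW, wedgeTwo_eq]
    rfl
  rw [hW', alternatizeUncurryFin_smul, wedgeTwo_eq]
  congr 1
  rw [← neg_neg (alternatizeUncurryFin (_ ∘L B)), ← swap_alt, ← alternatizeUncurryFinCLM_apply,
    ← map_neg, alternatizeUncurryFinCLM_apply]
  congr 1
  ext v : 1
  have hB : B.flip v = alternatizeUncurryFinCLM ℝ E ℝ ∘L
      (ContinuousLinearMap.smulRightL ℝ E (Alt E k) (o v) ∘L A) := by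
    ext u : 1; rfl
  rw [_root_.neg_apply, ContinuousLinearMap.comp_apply, hB,
    alternatizeUncurryFinCLM_apply, alt_smulRight_swap, neg_neg]
  rfl

/-- Alternation in three arguments. -/
def alt3 (G : E →L[ℝ] E →L[ℝ] E →L[ℝ] Alt E k) : Alt E (k + 3) :=
  alternatizeUncurryFin (alternatizeUncurryFinCLM ℝ E ℝ ∘L
    (ContinuousLinearMap.compL ℝ E (E →L[ℝ] Alt E k) (Alt E (k+1)) (alternatizeUncurryFinCLM ℝ E ℝ)
      ∘L G))

theorem alt3_swap12 (G : E →L[ℝ] E →L[ℝ] E →L[ℝ] Alt E k) : alt3 G.flip = - alt3 G := by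
  rw [alt3, alt3, ← swap_alt]; rfl

def flip23 (G : E →L[ℝ] E →L[ℝ] E →L[ℝ] Alt E k) : E →L[ℝ] E →L[ℝ] E →L[ℝ] Alt E k :=
  ((ContinuousLinearMap.flipₗᵢ ℝ E E (Alt E k)) : _ →L[ℝ] (E →L[ℝ] E →L[ℝ] Alt E k)) ∘L G

theorem alt3_swap23 (G : E →L[ℝ] E →L[ℝ] E →L[ℝ] Alt E k) : alt3 (flip23 G) = - alt3 G := by
  rw [alt3, alt3, ← alternatizeUncurryFinCLM_apply, ← alternatizeUncurryFinCLM_apply, ← map_neg]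
  congr 1
  ext u : 1
  exact swap_alt (G u)

theorem alt3_add (G H : E →L[ℝ] E →L[ℝ] E →L[ℝ] Alt E k) : alt3 (G + H) = alt3 G + alt3 H := by
  simp only [alt3, ContinuousLinearMap.comp_add, alternatizeUncurryFin_add]

theorem wedgeTwo_alt_left (X : E →L[ℝ] Alt E 2) (α : Alt E k) (W : E →L[ℝ] Alt E (k + 2))
    (hW : ∀ u, W u = wedgeTwo (X u) α) (hX : alternatizeUncurryFin X = 0) :
    alternatizeUncurryFin W = 0 := by
  let G : E →L[ℝ] E →L[ℝ] E →L[ℝ] Alt E k :=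
    (ContinuousLinearMap.compL ℝ E (Alt E 1) (E →L[ℝ] Alt E k)
      ((ContinuousLinearMap.smulRightL ℝ E (Alt E k)).flip α ∘L
      ((ofSubsingletonLIE (𝕜 := ℝ) (E := E) (F := ℝ) (0 : Fin 1)).symm : Alt E 1 →L[ℝ] E →L[ℝ] ℝ))) ∘L
      ((curryLeftLI : Alt E 2 →ₗᵢ[ℝ] E →L[ℝ] Alt E 1).toContinuousLinearMap) ∘L X
  have hG : ∀ u v w, G u v w = X u ![v, w] • α := by
    intro u v w
    show ((ofSubsingletonLIE (𝕜 := ℝ) (E := E) (F := ℝ) (0 : Fin 1)).symm ((X u).curryLeft v)) w • α = _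
    congr 1
    exact oneForm_apply _ _
  have hWG : alternatizeUncurryFin W = (2⁻¹ : ℝ) • alt3 G := by
    rw [alt3, ← alternatizeUncurryFin_smul]
    congr 1
    ext u : 1
    rw [hW]; rfl
  have hsum : G + (flip23 G.flip + -G.flip) = 0 := by
    ext u v w : 3
    have h0 : ∑ i : Fin 3, (-1) ^ (i : ℕ) • X (![u, v, w] i) (i.removeNth ![u, v, w]) = 0 :=
      (alternatizeUncurryFin_apply X ![u, v, w]).symm.trans
        (congrArg (fun f : Alt E 3 => f ![u, v, w]) hX)
    have e0 : (0 : Fin 3).removeNth ![u, v, w] = ![v, w] := by ext i; fin_cases i <;> rfl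
    have e1 : (1 : Fin 3).removeNth ![u, v, w] = ![u, w] := by ext i; fin_cases i <;> rfl
    have e2 : (2 : Fin 3).removeNth ![u, v, w] = ![u, v] := by ext i; fin_cases i <;> rfl
    rw [Fin.sum_univ_three, e0, e1, e2] at h0
    have h : X u ![v, w] + (X w ![u, v] - X v ![u, w]) = 0 := by
      rw [← h0]; simp; ring
    have e : (G + (flip23 G.flip + -G.flip)) u v w = G u v w + (G w u v - G v u w) := by
      rw [sub_eq_add_neg]; rfl
    rw [e, hG, hG, hG, ← sub_smul, ← add_smul, h, zero_smul]
    rfl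
  have h3 := congrArg alt3 hsum
  have hz : alt3 (0 : E →L[ℝ] E →L[ℝ] E →L[ℝ] Alt E k) = 0 := by
    have := alt3_add (0 : E →L[ℝ] E →L[ℝ] E →L[ℝ] Alt E k) 0
    rw [show (0 : E →L[ℝ] E →L[ℝ] E →L[ℝ] Alt E k) + 0 = 0 from by ext u v w : 3; simp] at this
    exact left_eq_add.1 this
  have hn : alt3 (-G.flip) = alt3 G := by
    have := alt3_add (G.flip) (-G.flip)
    rw [show G.flip + -G.flip = 0 from by ext u v w : 3; exact add_neg_cancel _, hz, alt3_swap12] at this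
    exact (neg_add_eq_zero.1 this.symm).symm
  rw [alt3_add, alt3_add, hn, alt3_swap23, alt3_swap12, neg_neg, hz] at h3
  rw [hWG]
  have h4 : (3 : ℝ) • alt3 G = 0 := by rw [← h3]; module
  rw [(smul_eq_zero.1 h4).resolve_left (by norm_num), smul_zero]

/-- `wedgeOne` as a continuous bilinear map. -/
def wedgeOneL (k : ℕ) : Alt E 1 →L[ℝ] Alt E k →L[ℝ] Alt E (k + 1) :=
  ContinuousLinearMap.compL ℝ (Alt E k) (E →L[ℝ] Alt E k) (Alt E (k + 1))
      (alternatizeUncurryFinCLM ℝ E ℝ) ∘L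
    ContinuousLinearMap.smulRightL ℝ E (Alt E k) ∘L
      ((ofSubsingletonLIE (𝕜 := ℝ) (E := E) (F := ℝ) (0 : Fin 1)).symm : Alt E 1 →L[ℝ] E →L[ℝ] ℝ)

theorem wedgeOneL_apply (θ : Alt E 1) (α : Alt E k) : wedgeOneL k θ α = wedgeOne θ α := rfl

/-- `wedgeTwo` as a continuous bilinear map (arguments in the order `α`, `σ`). -/
def wedgeTwoL (k : ℕ) : Alt E k →L[ℝ] Alt E 2 →L[ℝ] Alt E (k + 2) :=
  (ContinuousLinearMap.compL ℝ (Alt E 2) (E →L[ℝ] E →L[ℝ] Alt E k) (Alt E (k + 2))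
      ((2⁻¹ : ℝ) • (alternatizeUncurryFinCLM ℝ E ℝ ∘L
        ContinuousLinearMap.compL ℝ E (E →L[ℝ] Alt E k) (Alt E (k + 1))
          (alternatizeUncurryFinCLM ℝ E ℝ)))) ∘L
    ((ContinuousLinearMap.compL ℝ (Alt E 2) (E →L[ℝ] Alt E 1) (E →L[ℝ] E →L[ℝ] Alt E k)).flip
      (curryLeftLI : Alt E 2 →ₗᵢ[ℝ] E →L[ℝ] Alt E 1).toContinuousLinearMap) ∘L
    (ContinuousLinearMap.compL ℝ E (Alt E 1) (E →L[ℝ] Alt E k)) ∘L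
    ((ContinuousLinearMap.compL ℝ (Alt E 1) (E →L[ℝ] ℝ) (E →L[ℝ] Alt E k)).flip
      ((ofSubsingletonLIE (𝕜 := ℝ) (E := E) (F := ℝ) (0 : Fin 1)).symm :
        Alt E 1 →L[ℝ] E →L[ℝ] ℝ)) ∘L
    (ContinuousLinearMap.smulRightL ℝ E (Alt E k)).flip

theorem wedgeTwoL_apply (σ : Alt E 2) (α : Alt E k) : wedgeTwoL k α σ = wedgeTwo σ α := rfl

theorem wedgeOne_comp (θ : Alt E 1) (α : Alt E k) (g : E →L[ℝ] E) :
    wedgeOne (θ.compContinuousLinearMap g) (α.compContinuousLinearMap g) =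
      (wedgeOne θ α).compContinuousLinearMap g := by
  ext v
  simp only [wedgeOne_apply, compContinuousLinearMap_apply]
  refine Finset.sum_congr rfl fun i _ => ?_
  congr 3
  ext j; fin_cases j; rfl

theorem wedgeTwo_comp (σ : Alt E 2) (α : Alt E k) (g : E →L[ℝ] E) :
    wedgeTwo (σ.compContinuousLinearMap g) (α.compContinuousLinearMap g) =
      (wedgeTwo σ α).compContinuousLinearMap g := by
  ext v
  simp only [wedgeTwo_apply, compContinuousLinearMap_apply]
  refine Finset.sum_congr rfl fun i _ => Finset.sum_congr rfl fun j _ => ?_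
  congr 3
  ext l; fin_cases l <;> rfl

theorem contDiff_compCLM (k : ℕ) : ContDiff ℝ ∞ (fun g : E →L[ℝ] E =>
    (compContinuousLinearMapCLM g : Alt E k →L[ℝ] Alt E k)) := by
  induction k with
  | zero =>
    have : (fun g : E →L[ℝ] E => (compContinuousLinearMapCLM g : Alt E 0 →L[ℝ] Alt E 0)) =
        fun _ => ContinuousLinearMap.id ℝ _ := by
      ext g f v
      simp only [compContinuousLinearMapCLM_apply, compContinuousLinearMap_apply,
        ContinuousLinearMap.id_apply]
      congr 1; ext i; exact i.elim0
    rw [this]; exact contDiff_const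
  | succ k ih =>
    have : (fun g : E →L[ℝ] E => (compContinuousLinearMapCLM g : Alt E (k+1) →L[ℝ] Alt E (k+1))) =
        fun g => ((k + 1 : ℝ)⁻¹ • alternatizeUncurryFinCLM ℝ E ℝ) ∘L
          ((ContinuousLinearMap.compL ℝ E (Alt E k) (Alt E k) (compContinuousLinearMapCLM g)) ∘L
          ((ContinuousLinearMap.compL ℝ E E (Alt E k)).flip g) ∘L
          (curryLeftLI : Alt E (k+1) →ₗᵢ[ℝ] E →L[ℝ] Alt E k).toContinuousLinearMap) := by
      ext g f : 2
      have h : (((ContinuousLinearMap.compL ℝ E (Alt E k) (Alt E k) (compContinuousLinearMapCLM g)) ∘L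
          ((ContinuousLinearMap.compL ℝ E E (Alt E k)).flip g) ∘L
          (curryLeftLI : Alt E (k+1) →ₗᵢ[ℝ] E →L[ℝ] Alt E k).toContinuousLinearMap)) f =
          (f.compContinuousLinearMap g).curryLeft := by
        ext x : 1
        rw [curryLeft_compContinuousLinearMap]; rfl
      rw [ContinuousLinearMap.comp_apply, h]
      show _ = (k + 1 : ℝ)⁻¹ • alternatizeUncurryFin _
      rw [alternatizeUncurryFin_curryLeft, compContinuousLinearMapCLM_apply,
        ← Nat.cast_smul_eq_nsmul ℝ, smul_smul]
      push_cast
      rw [inv_mul_cancel₀ (by positivity), one_smul]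
    rw [this]
    refine contDiff_const.clm_comp (ContDiff.clm_comp ?_ (ContDiff.clm_comp ?_ contDiff_const))
    · exact (ContinuousLinearMap.contDiff _).comp ih
    · exact ContinuousLinearMap.contDiff _
end

section
variable {E : Type*} [NormedAddCommGroup E] [NormedSpace ℝ E]
  {M : Type*} [TopologicalSpace M] [ChartedSpace E M] {k : ℕ}

/-- Families of alternating `k`-forms on the tangent spaces, with no smoothness condition. -/
abbrev RawForm (E M : Type*) [NormedAddCommGroup E] [NormedSpace ℝ E] [TopologicalSpace M]
    [ChartedSpace E M] (k : ℕ) : Type _ :=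
  ∀ x : M, TangentSpace 𝓘(ℝ, E) x [⋀^Fin k]→L[ℝ] Bundle.Trivial M ℝ x

/-- The local expression of a form in the chart at `x₀`: its pullback under the inverse chart. -/
def inChart (s : RawForm E M k) (x₀ : M) (y : E) : E [⋀^Fin k]→L[ℝ] ℝ :=
  (s ((extChartAt 𝓘(ℝ, E) x₀).symm y)).compContinuousLinearMap
    (mfderiv 𝓘(ℝ, E) 𝓘(ℝ, E) (extChartAt 𝓘(ℝ, E) x₀).symm y)

theorem transition_eventually (x₀ x₁ : M) (y : E)
    (hy : y ∈ (extChartAt 𝓘(ℝ, E) x₀).target)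
    (hy' : (extChartAt 𝓘(ℝ, E) x₀).symm y ∈ (extChartAt 𝓘(ℝ, E) x₁).source) :
    ∀ᶠ z in 𝓝 y, z ∈ (extChartAt 𝓘(ℝ, E) x₀).target ∧
      (extChartAt 𝓘(ℝ, E) x₀).symm z ∈ (extChartAt 𝓘(ℝ, E) x₁).source := by
  have h1 := (isOpen_extChartAt_target (I := 𝓘(ℝ, E)) x₀).mem_nhds hy
  have h2 : ContinuousAt (extChartAt 𝓘(ℝ, E) x₀).symm y := continuousAt_extChartAt_symm'' hy
  exact Filter.Eventually.and h1
    (h2.eventually ((isOpen_extChartAt_source (I := 𝓘(ℝ, E)) x₁).mem_nhds hy'))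

variable [IsManifold 𝓘(ℝ, E) ∞ M]

/-- Smooth differential `k`-forms on `M`: the `C^∞` sections of the bundle of alternating
`k`-forms on the tangent spaces. -/
def DiffForm (E M : Type*) [NormedAddCommGroup E] [NormedSpace ℝ E] [TopologicalSpace M]
    [ChartedSpace E M] [IsManifold 𝓘(ℝ, E) ∞ M] (k : ℕ) : Type _ :=
  ContMDiffSection 𝓘(ℝ, E) (E [⋀^Fin k]→L[ℝ] ℝ) ∞
    (fun x : M => TangentSpace 𝓘(ℝ, E) x [⋀^Fin k]→L[ℝ] Bundle.Trivial M ℝ x)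

namespace DiffForm

instance : DFunLike (DiffForm E M k) M
    (fun x => TangentSpace 𝓘(ℝ, E) x [⋀^Fin k]→L[ℝ] Bundle.Trivial M ℝ x) :=
  inferInstanceAs (DFunLike (ContMDiffSection _ _ _ _) _ _)

instance : AddCommGroup (DiffForm E M k) :=
  inferInstanceAs (AddCommGroup (ContMDiffSection 𝓘(ℝ, E) (E [⋀^Fin k]→L[ℝ] ℝ) ∞
    (fun x : M => TangentSpace 𝓘(ℝ, E) x [⋀^Fin k]→L[ℝ] Bundle.Trivial M ℝ x)))

instance : Module ℝ (DiffForm E M k) :=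
  inferInstanceAs (Module ℝ (ContMDiffSection 𝓘(ℝ, E) (E [⋀^Fin k]→L[ℝ] ℝ) ∞
    (fun x : M => TangentSpace 𝓘(ℝ, E) x [⋀^Fin k]→L[ℝ] Bundle.Trivial M ℝ x)))

theorem ext {α β : DiffForm E M k} (h : ∀ x, α x = β x) : α = β := DFunLike.ext _ _ h

theorem coe_add (α β : DiffForm E M k) : ⇑(α + β) = ⇑α + ⇑β := rfl

theorem coe_neg (α : DiffForm E M k) : ⇑(-α) = -⇑α := rfl

theorem coe_smul (c : ℝ) (α : DiffForm E M k) : ⇑(c • α) = c • ⇑α := rfl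

end DiffForm

theorem triv_eq_inChart (s : RawForm E M k) (x₀ x : M)
    (hx : x ∈ (extChartAt 𝓘(ℝ, E) x₀).source) :
    (trivializationAt (E [⋀^Fin k]→L[ℝ] ℝ)
      (fun x : M => TangentSpace 𝓘(ℝ, E) x [⋀^Fin k]→L[ℝ] Bundle.Trivial M ℝ x) x₀ ⟨x, s x⟩).2
      = inChart s x₀ (extChartAt 𝓘(ℝ, E) x₀ x) := by
  have h2 := (extChartAt 𝓘(ℝ, E) x₀).left_inv hx
  have hx' : x ∈ (chartAt E x₀).source := by simpa using hx
  have h := TangentBundle.symmL_trivializationAt (I := 𝓘(ℝ, E)) hx'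
  rw [FiberBundle.trivializationAt_continuousAlternatingMap_apply]
  ext v
  simp only [ContinuousAlternatingMap.inCoordinates, inChart]
  rw [h]
  simp only [modelWithCornersSelf_coe, Set.range_id, mfderivWithin_univ]
  have key : ∀ z, z = x → ∀ (A : E →L[ℝ] E) (v : Fin k → E),
      (ContinuousAlternatingMap.compContinuousLinearMap (s x) A : E [⋀^Fin k]→L[ℝ] ℝ) v
      = (ContinuousAlternatingMap.compContinuousLinearMap (s z) A : E [⋀^Fin k]→L[ℝ] ℝ) v := by
    rintro z rfl A v; rfl
  refine Eq.trans ?_ (key _ h2 _ v)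
  have ht : ∀ w : ℝ, Bundle.Trivialization.continuousLinearMapAt ℝ
      (trivializationAt ℝ (Bundle.Trivial M ℝ) x₀) x w = w := by
    intro w; simp
  exact ht _

theorem fderiv_transition (x₀ x₁ : M) (y : E)
    (hy : y ∈ (extChartAt 𝓘(ℝ, E) x₀).target)
    (hy' : (extChartAt 𝓘(ℝ, E) x₀).symm y ∈ (extChartAt 𝓘(ℝ, E) x₁).source) :
    fderiv ℝ (extChartAt 𝓘(ℝ, E) x₁ ∘ (extChartAt 𝓘(ℝ, E) x₀).symm) y =
      (mfderiv 𝓘(ℝ, E) 𝓘(ℝ, E) (extChartAt 𝓘(ℝ, E) x₁) ((extChartAt 𝓘(ℝ, E) x₀).symm y)).comp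
        (mfderiv 𝓘(ℝ, E) 𝓘(ℝ, E) (extChartAt 𝓘(ℝ, E) x₀).symm y) := by
  have hI : IsManifold 𝓘(ℝ, E) 1 M := IsManifold.of_le (n := ∞) (by norm_num)
  have h0 : MDifferentiableAt 𝓘(ℝ, E) 𝓘(ℝ, E) (extChartAt 𝓘(ℝ, E) x₀).symm y := by
    have := mdifferentiableWithinAt_extChartAt_symm (I := 𝓘(ℝ, E)) hy
    simpa only [modelWithCornersSelf_coe, Set.range_id, mdifferentiableWithinAt_univ] using this
  have h1 : MDifferentiableAt 𝓘(ℝ, E) 𝓘(ℝ, E) (extChartAt 𝓘(ℝ, E) x₁)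
      ((extChartAt 𝓘(ℝ, E) x₀).symm y) := mdifferentiableAt_extChartAt (by simpa using hy')
  rw [← mfderiv_eq_fderiv]
  exact mfderiv_comp y h1 h0

/-- Change of charts. -/
theorem inChart_transition (s : RawForm E M k) (x₀ x₁ : M) (y : E)
    (hy : y ∈ (extChartAt 𝓘(ℝ, E) x₀).target)
    (hy' : (extChartAt 𝓘(ℝ, E) x₀).symm y ∈ (extChartAt 𝓘(ℝ, E) x₁).source) :
    inChart s x₀ y =
      (inChart s x₁ ((extChartAt 𝓘(ℝ, E) x₁ ∘ (extChartAt 𝓘(ℝ, E) x₀).symm) y)).compContinuousLinearMap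
        (fderiv ℝ (extChartAt 𝓘(ℝ, E) x₁ ∘ (extChartAt 𝓘(ℝ, E) x₀).symm) y) := by
  have hI : IsManifold 𝓘(ℝ, E) 1 M := IsManifold.of_le (n := ∞) (by norm_num)
  have e1 := fderiv_transition x₀ x₁ y hy hy'
  have h3 := mfderivWithin_extChartAt_symm_comp_mfderiv_extChartAt' (I := 𝓘(ℝ, E)) hy'
  simp only [modelWithCornersSelf_coe, Set.range_id, mfderivWithin_univ] at h3
  rw [e1]
  have h4 := (extChartAt 𝓘(ℝ, E) x₁).left_inv hy'
  simp only [inChart, Function.comp_apply]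
  have key : ∀ (z w : M), z = w → ∀ (A B : E →L[ℝ] E), A = B →
      (ContinuousAlternatingMap.compContinuousLinearMap (s w) A : E [⋀^Fin k]→L[ℝ] ℝ)
      = (ContinuousAlternatingMap.compContinuousLinearMap (s z) B : E [⋀^Fin k]→L[ℝ] ℝ) := by
    rintro z _ rfl A _ rfl; rfl
  refine (key _ _ h4 _ ((mfderiv 𝓘(ℝ, E) 𝓘(ℝ, E) (extChartAt 𝓘(ℝ, E) x₁).symm
    (extChartAt 𝓘(ℝ, E) x₁ ((extChartAt 𝓘(ℝ, E) x₀).symm y))).comp (((mfderiv 𝓘(ℝ, E) 𝓘(ℝ, E) (extChartAt 𝓘(ℝ, E) x₁) ((extChartAt 𝓘(ℝ, E) x₀).symm y)).comp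
        (mfderiv 𝓘(ℝ, E) 𝓘(ℝ, E) (extChartAt 𝓘(ℝ, E) x₀).symm y)))) ?_).trans rfl
  have := congrArg (fun A : E →L[ℝ] E => A.comp (mfderiv 𝓘(ℝ, E) 𝓘(ℝ, E) (extChartAt 𝓘(ℝ, E) x₀).symm y : E →L[ℝ] E)) h3
  exact this.symm

theorem contDiffAt_transition (x₀ x₁ : M) (y : E)
    (hy : y ∈ (extChartAt 𝓘(ℝ, E) x₀).target)
    (hy' : (extChartAt 𝓘(ℝ, E) x₀).symm y ∈ (extChartAt 𝓘(ℝ, E) x₁).source) :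
    ContDiffAt ℝ ∞ (extChartAt 𝓘(ℝ, E) x₁ ∘ (extChartAt 𝓘(ℝ, E) x₀).symm) y := by
  rw [← contMDiffAt_iff_contDiffAt]
  have h1 : ContMDiffAt 𝓘(ℝ, E) 𝓘(ℝ, E) ∞ (extChartAt 𝓘(ℝ, E) x₁)
    ((extChartAt 𝓘(ℝ, E) x₀).symm y) := contMDiffAt_extChartAt' (by simpa using hy')
  have h0 : ContMDiffAt 𝓘(ℝ, E) 𝓘(ℝ, E) ∞ (extChartAt 𝓘(ℝ, E) x₀).symm y :=
    (contMDiffOn_extChartAt_symm x₀).contMDiffAt ((isOpen_extChartAt_target x₀).mem_nhds hy)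
  exact h1.comp y h0

theorem contMDiffAt_section_iff_inChart (s : RawForm E M k) (x₀ : M) :
    ContMDiffAt 𝓘(ℝ, E) (𝓘(ℝ, E).prod 𝓘(ℝ, E [⋀^Fin k]→L[ℝ] ℝ)) ∞
      (fun x => Bundle.TotalSpace.mk' (E [⋀^Fin k]→L[ℝ] ℝ)
        (E := fun x : M => TangentSpace 𝓘(ℝ, E) x [⋀^Fin k]→L[ℝ] Bundle.Trivial M ℝ x) x (s x)) x₀
      ↔ ContDiffAt ℝ ∞ (inChart s x₀) (extChartAt 𝓘(ℝ, E) x₀ x₀) := by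
  rw [Bundle.contMDiffAt_section, ← contMDiffAt_iff_contDiffAt]
  have hx0 := mem_extChartAt_source (I := 𝓘(ℝ, E)) x₀
  have hev : ∀ᶠ x in 𝓝 x₀, x ∈ (extChartAt 𝓘(ℝ, E) x₀).source :=
    (isOpen_extChartAt_source x₀).mem_nhds hx0
  constructor
  · intro h
    have h0 : ContMDiffAt 𝓘(ℝ, E) 𝓘(ℝ, E) ∞ (extChartAt 𝓘(ℝ, E) x₀).symm
        (extChartAt 𝓘(ℝ, E) x₀ x₀) :=
      (contMDiffOn_extChartAt_symm x₀).contMDiffAt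
        ((isOpen_extChartAt_target x₀).mem_nhds (mem_extChartAt_target x₀))
    have h' := ContMDiffAt.comp_of_eq (f := (extChartAt 𝓘(ℝ, E) x₀).symm)
      h h0 (extChartAt_to_inv x₀)
    refine h'.congr_of_eventuallyEq ?_
    filter_upwards [(isOpen_extChartAt_target (I := 𝓘(ℝ, E)) x₀).mem_nhds (mem_extChartAt_target x₀)]
      with y hy
    rw [Function.comp_apply, triv_eq_inChart s x₀ _ ((extChartAt 𝓘(ℝ, E) x₀).map_target hy),
      (extChartAt 𝓘(ℝ, E) x₀).right_inv hy]
  · intro h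
    have h' := h.comp x₀ (contMDiffAt_extChartAt (I := 𝓘(ℝ, E)))
    refine h'.congr_of_eventuallyEq ?_
    filter_upwards [hev] with x hx
    rw [triv_eq_inChart s x₀ x hx]; rfl

theorem DiffForm.contDiffAt_inChart (α : DiffForm E M k) (x₀ : M) {y : E}
    (hy : y ∈ (extChartAt 𝓘(ℝ, E) x₀).target) : ContDiffAt ℝ ∞ (inChart α x₀) y := by
  set x₁ := (extChartAt 𝓘(ℝ, E) x₀).symm y with hx₁
  have hy' : (extChartAt 𝓘(ℝ, E) x₀).symm y ∈ (extChartAt 𝓘(ℝ, E) x₁).source :=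
    mem_extChartAt_source x₁
  have h1 := (contMDiffAt_section_iff_inChart (α : RawForm E M k) x₁).1 (ContMDiffSection.contMDiff α x₁)
  have hτ := contDiffAt_transition x₀ x₁ y hy hy'
  have h2 : ContDiffAt ℝ ∞ (fun z => (inChart α x₁ ((extChartAt 𝓘(ℝ, E) x₁ ∘
      (extChartAt 𝓘(ℝ, E) x₀).symm) z)).compContinuousLinearMap
        (fderiv ℝ (extChartAt 𝓘(ℝ, E) x₁ ∘ (extChartAt 𝓘(ℝ, E) x₀).symm) z)) y := by
    have h1' : ContDiffAt ℝ ∞ (inChart α x₁) ((extChartAt 𝓘(ℝ, E) x₁ ∘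
      (extChartAt 𝓘(ℝ, E) x₀).symm) y) := h1
    have h3 : ContDiffAt ℝ ∞ (fun z => inChart α x₁ ((extChartAt 𝓘(ℝ, E) x₁ ∘
      (extChartAt 𝓘(ℝ, E) x₀).symm) z)) y := h1'.comp y hτ
    have h4 : ContDiffAt ℝ ∞ (fderiv ℝ (extChartAt 𝓘(ℝ, E) x₁ ∘
      (extChartAt 𝓘(ℝ, E) x₀).symm)) y := hτ.fderiv_right (by norm_num)
    exact ((contDiff_compCLM (E := E) k).contDiffAt.comp y h4).clm_apply h3
  refine h2.congr_of_eventuallyEq ?_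
  filter_upwards [transition_eventually x₀ x₁ y hy hy'] with z hz
  exact inChart_transition _ x₀ x₁ z hz.1 hz.2

end
section
variable {E : Type*} [NormedAddCommGroup E] [NormedSpace ℝ E]
  {M : Type*} [TopologicalSpace M] [ChartedSpace E M] {k : ℕ}

theorem inChart_add (s t : RawForm E M k) (x₀ : M) :
    inChart (s + t) x₀ = inChart s x₀ + inChart t x₀ := rfl

theorem inChart_smul (c : ℝ) (s : RawForm E M k) (x₀ : M) :
    inChart (c • s) x₀ = c • inChart s x₀ := rfl

/-- Pointwise wedge product with a `1`-form. -/
def wedgeOneRaw (θ : RawForm E M 1) (s : RawForm E M k) : RawForm E M (k + 1) :=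
  fun x => wedgeOne (E := E) (θ x) (s x)

/-- Pointwise wedge product with a `2`-form. -/
def wedgeTwoRaw (σ : RawForm E M 2) (s : RawForm E M k) : RawForm E M (k + 2) :=
  fun x => wedgeTwo (E := E) (σ x) (s x)

theorem inChart_wedgeOneRaw (θ : RawForm E M 1) (s : RawForm E M k) (x₀ : M) (y : E) :
    inChart (wedgeOneRaw θ s) x₀ y = wedgeOne (inChart θ x₀ y) (inChart s x₀ y) :=
  (wedgeOne_comp (E := E) (θ _) (s _) _).symm

theorem inChart_wedgeTwoRaw (σ : RawForm E M 2) (s : RawForm E M k) (x₀ : M) (y : E) :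
    inChart (wedgeTwoRaw σ s) x₀ y = wedgeTwo (inChart σ x₀ y) (inChart s x₀ y) :=
  (wedgeTwo_comp (E := E) (σ _) (s _) _).symm

/-- The exterior derivative: at `x` it is the exterior derivative of the local expression in the
chart at `x`, pulled back to the tangent space at `x`. By `inChart_extD` any chart may be used. -/
def extDRaw (s : RawForm E M k) : RawForm E M (k + 1) := fun x =>
  (extDeriv (inChart s x) (extChartAt 𝓘(ℝ, E) x x)).compContinuousLinearMap
    (mfderiv 𝓘(ℝ, E) 𝓘(ℝ, E) (extChartAt 𝓘(ℝ, E) x) x)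

variable [IsManifold 𝓘(ℝ, E) ∞ M]

theorem rawForm_ext {s t : RawForm E M k}
    (h : ∀ x, inChart s x (extChartAt 𝓘(ℝ, E) x x) = inChart t x (extChartAt 𝓘(ℝ, E) x x)) :
    s = t := by
  funext x
  have hI : IsManifold 𝓘(ℝ, E) 1 M := IsManifold.of_le (n := ∞) (by norm_num)
  have hx := mem_extChartAt_source (I := 𝓘(ℝ, E)) x
  have h3 := mfderivWithin_extChartAt_symm_comp_mfderiv_extChartAt' (I := 𝓘(ℝ, E)) hx
  simp only [modelWithCornersSelf_coe, Set.range_id, mfderivWithin_univ] at h3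
  have key : ∀ r : RawForm E M k, (inChart r x (extChartAt 𝓘(ℝ, E) x x)).compContinuousLinearMap
      (mfderiv 𝓘(ℝ, E) 𝓘(ℝ, E) (extChartAt 𝓘(ℝ, E) x) x) = r x := by
    intro r
    have h4 := (extChartAt 𝓘(ℝ, E) x).left_inv hx
    have k2 : ∀ z w : M, z = w → ∀ A : E →L[ℝ] E, A = ContinuousLinearMap.id ℝ E →
        (ContinuousAlternatingMap.compContinuousLinearMap (r z) A : E [⋀^Fin k]→L[ℝ] ℝ) = r w := by
      rintro z _ rfl A rfl; rfl
    refine Eq.trans ?_ (k2 _ _ h4 _ h3)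
    rfl
  rw [← key s, h, key]

theorem inChart_extDRaw (α : DiffForm E M k) (x₀ : M) {y : E}
    (hy : y ∈ (extChartAt 𝓘(ℝ, E) x₀).target) :
    inChart (extDRaw (α : RawForm E M k)) x₀ y = extDeriv (inChart α x₀) y := by
  set x₁ := (extChartAt 𝓘(ℝ, E) x₀).symm y with hx₁
  have hy' : (extChartAt 𝓘(ℝ, E) x₀).symm y ∈ (extChartAt 𝓘(ℝ, E) x₁).source :=
    mem_extChartAt_source x₁
  have hτ := contDiffAt_transition x₀ x₁ y hy hy'
  have h1 : DifferentiableAt ℝ (inChart α x₁) ((extChartAt 𝓘(ℝ, E) x₁ ∘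
      (extChartAt 𝓘(ℝ, E) x₀).symm) y) :=
    (α.contDiffAt_inChart x₁ (mem_extChartAt_target x₁)).differentiableAt (by norm_num)
  have h2 : inChart α x₀ =ᶠ[𝓝 y] fun z => (inChart α x₁ ((extChartAt 𝓘(ℝ, E) x₁ ∘
      (extChartAt 𝓘(ℝ, E) x₀).symm) z)).compContinuousLinearMap
        (fderiv ℝ (extChartAt 𝓘(ℝ, E) x₁ ∘ (extChartAt 𝓘(ℝ, E) x₀).symm) z) := by
    filter_upwards [transition_eventually x₀ x₁ y hy hy'] with z hz
    exact inChart_transition _ x₀ x₁ z hz.1 hz.2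
  have hr : minSmoothness ℝ 2 ≤ (∞ : WithTop ℕ∞) := by
    rw [minSmoothness_of_isRCLikeNormedField]; exact ENat.LEInfty.out
  rw [h2.extDeriv_eq, extDeriv_pullback h1 hτ hr,
    fderiv_transition x₀ x₁ y hy hy']
  rfl

/-- A differential form from a family whose local expressions are smooth. -/
def DiffForm.mkOf (s : RawForm E M k)
    (h : ∀ x₀, ContDiffAt ℝ ∞ (inChart s x₀) (extChartAt 𝓘(ℝ, E) x₀ x₀)) : DiffForm E M k :=
  ContMDiffSection.mk s fun x => (contMDiffAt_section_iff_inChart s x).2 (h x)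

theorem contDiffAt_inChart_extDRaw (α : DiffForm E M k) (x₀ : M) :
    ContDiffAt ℝ ∞ (inChart (extDRaw (α : RawForm E M k)) x₀) (extChartAt 𝓘(ℝ, E) x₀ x₀) := by
  have h : ContDiffAt ℝ ∞ (extDeriv (inChart α x₀)) (extChartAt 𝓘(ℝ, E) x₀ x₀) :=
    (alternatizeUncurryFinCLM ℝ E ℝ).contDiff.contDiffAt.comp _
      ((α.contDiffAt_inChart x₀ (mem_extChartAt_target x₀)).fderiv_right (by norm_num))
  refine h.congr_of_eventuallyEq ?_
  filter_upwards [(isOpen_extChartAt_target (I := 𝓘(ℝ, E)) x₀).mem_nhds (mem_extChartAt_target x₀)]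
    with y hy using inChart_extDRaw α x₀ hy

theorem DiffForm.ext_inChart {α β : DiffForm E M k}
    (h : ∀ x, inChart α x (extChartAt 𝓘(ℝ, E) x x) = inChart β x (extChartAt 𝓘(ℝ, E) x x)) :
    α = β := DFunLike.coe_injective (rawForm_ext h)

/-- The exterior derivative `d : Ω^k(M) → Ω^{k+1}(M)`. -/
def extD (k : ℕ) : DiffForm E M k →ₗ[ℝ] DiffForm E M (k + 1) where
  toFun α := DiffForm.mkOf (extDRaw (α : RawForm E M k)) (contDiffAt_inChart_extDRaw α)
  map_add' α β := by
    refine DiffForm.ext_inChart fun x => ?_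
    have hx := mem_extChartAt_target (I := 𝓘(ℝ, E)) x
    refine (inChart_extDRaw (α + β) x hx).trans ?_
    refine Eq.trans ?_ (congrArg₂ (· + ·) (inChart_extDRaw α x hx) (inChart_extDRaw β x hx)).symm
    exact extDeriv_add ((α.contDiffAt_inChart x hx).differentiableAt (by norm_num))
      ((β.contDiffAt_inChart x hx).differentiableAt (by norm_num))
  map_smul' c α := by
    refine DiffForm.ext_inChart fun x => ?_
    have hx := mem_extChartAt_target (I := 𝓘(ℝ, E)) x
    refine (inChart_extDRaw (c • α) x hx).trans ?_
    refine Eq.trans ?_ (congrArg (c • ·) (inChart_extDRaw α x hx)).symm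
    exact extDeriv_smul c (inChart α x)

/-- In every chart, `d` is the exterior derivative of the local expression. -/
theorem inChart_extD (α : DiffForm E M k) (x₀ : M) {y : E}
    (hy : y ∈ (extChartAt 𝓘(ℝ, E) x₀).target) :
    inChart (extD k α) x₀ y = extDeriv (inChart α x₀) y := inChart_extDRaw α x₀ hy

/-- `α ↦ θ ∧ α` for a `1`-form `θ`. -/
def DiffForm.wedge1 (θ : DiffForm E M 1) (k : ℕ) : DiffForm E M k →ₗ[ℝ] DiffForm E M (k + 1) where
  toFun α := DiffForm.mkOf (wedgeOneRaw (θ : RawForm E M 1) (α : RawForm E M k)) fun x₀ => by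
    have hx := mem_extChartAt_target (I := 𝓘(ℝ, E)) x₀
    have h := (((wedgeOneL (E := E) k).contDiff.contDiffAt).comp _
      (θ.contDiffAt_inChart x₀ hx)).clm_apply (α.contDiffAt_inChart x₀ hx)
    exact h.congr_of_eventuallyEq (.of_forall fun y => inChart_wedgeOneRaw _ _ x₀ y)
  map_add' α β := DiffForm.ext fun x => map_add (wedgeOneL (E := E) k (θ x)) (α x) (β x)
  map_smul' c α := DiffForm.ext fun x => map_smul (wedgeOneL (E := E) k (θ x)) c (α x)

/-- `α ↦ σ ∧ α` for a `2`-form `σ`. -/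
def DiffForm.wedge2 (σ : DiffForm E M 2) (k : ℕ) : DiffForm E M k →ₗ[ℝ] DiffForm E M (k + 2) where
  toFun α := DiffForm.mkOf (wedgeTwoRaw (σ : RawForm E M 2) (α : RawForm E M k)) fun x₀ => by
    have hx := mem_extChartAt_target (I := 𝓘(ℝ, E)) x₀
    have h := (((wedgeTwoL (E := E) k).contDiff.contDiffAt).comp _
      (α.contDiffAt_inChart x₀ hx)).clm_apply (σ.contDiffAt_inChart x₀ hx)
    exact h.congr_of_eventuallyEq (.of_forall fun y => inChart_wedgeTwoRaw _ _ x₀ y)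
  map_add' α β := DiffForm.ext fun x =>
    congrArg (fun f => f (σ x)) (map_add (wedgeTwoL (E := E) k) (α x) (β x))
  map_smul' c α := DiffForm.ext fun x =>
    congrArg (fun f => f (σ x)) (map_smul (wedgeTwoL (E := E) k) c (α x))

theorem inChart_wedge1 (θ : DiffForm E M 1) (α : DiffForm E M k) (x₀ : M) (y : E) :
    inChart (θ.wedge1 k α) x₀ y = wedgeOne (inChart θ x₀ y) (inChart α x₀ y) :=
  inChart_wedgeOneRaw _ _ _ _

theorem inChart_wedge2 (σ : DiffForm E M 2) (α : DiffForm E M k) (x₀ : M) (y : E) :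
    inChart (σ.wedge2 k α) x₀ y = wedgeTwo (inChart σ x₀ y) (inChart α x₀ y) :=
  inChart_wedgeTwoRaw _ _ _ _
end
section
variable {E : Type*} [NormedAddCommGroup E] [NormedSpace ℝ E]
  {M : Type*} [TopologicalSpace M] [ChartedSpace E M] {k : ℕ}

theorem wedgeTwo_wedgeOne (σ : Alt E 2) (θ : Alt E 1) :
    (wedgeTwo σ θ : Alt E 3) = wedgeOne θ σ := by
  refine ContinuousAlternatingMap.ext fun v => ?_
  refine (wedgeTwo_apply σ θ v).trans (Eq.trans ?_ (wedgeOne_apply θ σ v).symm)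
  have hs : ∀ a b c d e f : ℝ, a = f → b = e → c = d → a + b + c = d + e + f := by
    intros; subst_vars; ring
  have h1 : ∀ w w' : Fin 1 → E, w 0 = w' 0 → θ w = θ w' := by
    intro w w' h; congr 1; ext i; fin_cases i; exact h
  have h2 : ∀ w w' : Fin 2 → E, w 0 = w' 0 → w 1 = w' 1 → σ w = σ w' := by
    intro w w' h h'; congr 1; ext i; fin_cases i; exacts [h, h']
  rw [Fin.sum_univ_three, Fin.sum_univ_two]
  rw [show Finset.Ici (0 : Fin (1 + 1)) = {0, 1} by decide,
    show Finset.Ici (1 : Fin (1 + 1)) = {1} by decide,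
    Finset.sum_pair (by decide), Finset.sum_singleton]
  have hm : ∀ (s s' a b c d : ℝ), s = s' → a = d → b = c → s * (a * b) = s' * (c * d) := by
    intros; subst_vars; ring
  refine hs _ _ _ _ _ _ ?_ ?_ ?_
  · exact hm _ _ _ _ _ _ (by simp) (h2 _ _ rfl rfl) (h1 _ _ rfl)
  · exact hm _ _ _ _ _ _ (by simp) (h2 _ _ rfl rfl) (h1 _ _ rfl)
  · exact hm _ _ _ _ _ _ (by simp) (h2 _ _ rfl rfl) (h1 _ _ rfl)

theorem wedgeOne_wedgeTwo (σ : Alt E 2) (θ : Alt E 1) (α : Alt E k) :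
    wedgeOne θ (wedgeTwo σ α) = wedgeTwo σ (wedgeOne θ α) := by
  refine wedgeTwo_alt σ _ _ fun u => ?_
  simp only [ContinuousLinearMap.smulRight_apply]
  rw [← wedgeTwoL_apply, ← wedgeTwoL_apply, map_smul]; rfl

theorem extDeriv_wedgeTwo {σ : E → Alt E 2} {α : E → Alt E k} {y : E} (θ : Alt E 1)
    (hσ : DifferentiableAt ℝ σ y) (hα : DifferentiableAt ℝ α y)
    (hd : extDeriv σ y = - wedgeOne θ (σ y)) :
    extDeriv (fun z => wedgeTwo (σ z) (α z)) y =
      wedgeTwo (σ y) (extDeriv α y) - wedgeOne θ (wedgeTwo (σ y) (α y)) := by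
  have h := ((wedgeTwoL (E := E) k).hasFDerivAt.comp y hα.hasFDerivAt).clm_apply hσ.hasFDerivAt
  have h' : fderiv ℝ (fun z => wedgeTwo (σ z) (α z)) y = _ := h.fderiv
  rw [extDeriv, h', alternatizeUncurryFin_add,
    wedgeTwo_alt (σ y) (fderiv ℝ α y) ((((wedgeTwoL k).comp (fderiv ℝ α y)).flip) (σ y))
      (fun u => rfl)]
  have h0 : alternatizeUncurryFin (fderiv ℝ σ y + (oneForm θ).smulRight (σ y)) = 0 := by
    rw [alternatizeUncurryFin_add]
    exact (congrArg (· + wedgeOne θ (σ y)) hd).trans (neg_add_cancel _)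
  have h1 := wedgeTwo_alt_left _ (α y) ((wedgeTwoL k (α y)).comp (fderiv ℝ σ y) +
    (oneForm θ).smulRight (wedgeTwo (σ y) (α y))) (fun u => by
      rw [← wedgeTwoL_apply, ← wedgeTwoL_apply]
      simp) h0
  rw [alternatizeUncurryFin_add] at h1
  rw [show ((wedgeTwoL (E := E) k) ∘ α) y = wedgeTwoL k (α y) from rfl,
    eq_neg_of_add_eq_zero_left h1, neg_add_eq_sub]
  rfl

variable [IsManifold 𝓘(ℝ, E) ∞ M]

/-- A locally conformally symplectic structure: a nondegenerate `2`-form `ω` and a closed `1`-form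
`θ` with `dω = -ω ∧ θ`. -/
structure LCSStructure (E M : Type*) [NormedAddCommGroup E] [NormedSpace ℝ E]
    [TopologicalSpace M] [ChartedSpace E M] [IsManifold 𝓘(ℝ, E) ∞ M] where
  omega : DiffForm E M 2
  theta : DiffForm E M 1
  nondegenerate : ∀ (x : M) (v : TangentSpace 𝓘(ℝ, E) x),
    (∀ w : TangentSpace 𝓘(ℝ, E) x, omega x ![v, w] = (0 : ℝ)) → v = 0
  d_theta : extD 1 theta = 0
  d_omega : extD 2 omega = -(omega.wedge2 1 theta : DiffForm E M 3)

namespace LCSStructure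
variable (S : LCSStructure E M)

/-- The twisted differential `d_l α = dα + l θ ∧ α`. -/
def d (l : ℤ) (j : ℕ) : DiffForm E M j →ₗ[ℝ] DiffForm E M (j + 1) :=
  extD j + (l : ℝ) • S.theta.wedge1 j

/-- `L α = ω ∧ α`. -/
def L (j : ℕ) : DiffForm E M j →ₗ[ℝ] DiffForm E M (j + 2) := S.omega.wedge2 j

theorem extD_L (j : ℕ) (α : DiffForm E M j) :
    extD (j + 2) (S.L j α) = S.L (j + 1) (extD j α) - S.theta.wedge1 (j + 2) (S.L j α) := by
  refine DiffForm.ext_inChart fun x => ?_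
  set y := extChartAt 𝓘(ℝ, E) x x
  have hx : y ∈ (extChartAt 𝓘(ℝ, E) x).target := mem_extChartAt_target (I := 𝓘(ℝ, E)) x
  have hd : extDeriv (inChart S.omega x) y = - wedgeOne (inChart S.theta x y) (inChart S.omega x y) := by
    rw [← inChart_extD S.omega x hx, S.d_omega, ← wedgeTwo_wedgeOne]
    exact congrArg Neg.neg (inChart_wedge2 S.omega S.theta x y)
  have h := extDeriv_wedgeTwo (inChart S.theta x y)
    ((S.omega.contDiffAt_inChart x hx).differentiableAt (by norm_num))
    ((α.contDiffAt_inChart x hx).differentiableAt (by norm_num)) hd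
  refine (inChart_extD _ x hx).trans ?_
  have e : inChart (S.L j α) x = fun z => wedgeTwo (inChart S.omega x z) (inChart α x z) :=
    funext fun z => inChart_wedge2 _ _ _ _
  rw [e, h]
  refine Eq.trans ?_ (congrArg₂ (· - ·) (inChart_wedge2 S.omega (extD j α) x y).symm
    (inChart_wedge1 S.theta (S.L j α) x y).symm)
  rw [inChart_extD _ x hx, e]

theorem wedge1_L (j : ℕ) (α : DiffForm E M j) :
    S.theta.wedge1 (j + 2) (S.L j α) = S.L (j + 1) (S.theta.wedge1 j α) :=
  DiffForm.ext fun x => wedgeOne_wedgeTwo (E := E) (S.omega x) (S.theta x) (α x)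

/-- `d_l L = L d_{l-1}`. -/
theorem d_L (l : ℤ) (j : ℕ) (α : DiffForm E M j) :
    S.d l (j + 2) (S.L j α) = S.L (j + 1) (S.d (l - 1) j α) := by
  simp only [d, LinearMap.add_apply, LinearMap.smul_apply, extD_L, map_add, map_smul, wedge1_L]
  push_cast
  module

end LCSStructure
end
end
section
variable {V W : ℕ → Type*} [∀ j, AddCommGroup (V j)] [∀ j, Module ℝ (V j)]
  [∀ j, AddCommGroup (W j)] [∀ j, Module ℝ (W j)]

/-- The image of the incoming differential; the incoming differential in degree `0` is zero. -/
def coboundaries (d : ∀ j, V j →ₗ[ℝ] V (j + 1)) : ∀ j, Submodule ℝ (V j)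
  | 0 => ⊥
  | j + 1 => LinearMap.range (d j)

/-- `ker (d j)` modulo the image of `d (j - 1)`. -/
abbrev Cohomology (d : ∀ j, V j →ₗ[ℝ] V (j + 1)) (j : ℕ) : Type _ :=
  LinearMap.ker (d j) ⧸ (coboundaries d j).submoduleOf (LinearMap.ker (d j))

/-- The class of a cocycle. -/
def Cohomology.mk (d : ∀ j, V j →ₗ[ℝ] V (j + 1)) (j : ℕ) :
    LinearMap.ker (d j) →ₗ[ℝ] Cohomology d j :=
  Submodule.mkQ _

/-- The map `[a] ↦ [f a]` induced on cohomology by a linear map which sends cocycles to cocycles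
and coboundaries to coboundaries. -/
def Cohomology.map (d : ∀ j, V j →ₗ[ℝ] V (j + 1)) (e : ∀ j, W j →ₗ[ℝ] W (j + 1)) {i j : ℕ}
    (f : V i →ₗ[ℝ] W j) (hker : ∀ a ∈ LinearMap.ker (d i), f a ∈ LinearMap.ker (e j))
    (hcob : ∀ a ∈ coboundaries d i, f a ∈ coboundaries e j) :
    Cohomology d i →ₗ[ℝ] Cohomology e j :=
  Submodule.mapQ _ _ (f.restrict hker) fun a ha => hcob a ha
end

section
variable {E : Type*} [NormedAddCommGroup E] [NormedSpace ℝ E]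
  {M : Type*} [TopologicalSpace M] [ChartedSpace E M] [IsManifold 𝓘(ℝ, E) ∞ M]

/-- Transport of forms along an equality of degrees. -/
def castDeg {a b : ℕ} (h : a = b) : DiffForm E M a →ₗ[ℝ] DiffForm E M b :=
  h ▸ LinearMap.id

namespace LCSStructure
variable (S : LCSStructure E M)

/-- The power `L^p`. -/
def Lpow : ∀ p j : ℕ, DiffForm E M j →ₗ[ℝ] DiffForm E M (j + 2 * p)
  | 0, _ => LinearMap.id
  | p + 1, j => S.L (j + 2 * p) ∘ₗ Lpow p j

/-- The filtration `F^p Ω^m = L^p Ω^{m - 2p}`, which is zero if `m < 2p`. -/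
def filtration : ℕ → ∀ m : ℕ, Submodule ℝ (DiffForm E M m)
  | 0, _ => ⊤
  | _ + 1, 0 => ⊥
  | _ + 1, 1 => ⊥
  | p + 1, m + 2 => (filtration p m).map (S.L m)

theorem d_mem_filtration (p : ℕ) : ∀ (l : ℤ) (m : ℕ) (α : DiffForm E M m),
    α ∈ S.filtration p m → S.d l m α ∈ S.filtration p (m + 1) := by
  induction p with
  | zero => exact fun l m α _ => Submodule.mem_top
  | succ p ih =>
    intro l m α h
    match m, α, h with
    | 0, α, h => rw [(Submodule.mem_bot ℝ).1 h, map_zero]; exact zero_mem _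
    | 1, α, h => rw [(Submodule.mem_bot ℝ).1 h, map_zero]; exact zero_mem _
    | m + 2, _, ⟨β, hβ, rfl⟩ => exact ⟨_, ih (l - 1) m β hβ, (S.d_L l m β).symm⟩

/-- `E_0^{p,q} = F^p Ω^{p+q} / F^{p+1} Ω^{p+q}`. -/
def E0 (p q : ℕ) : Type _ :=
  S.filtration p (p + q) ⧸ (S.filtration (p + 1) (p + q)).submoduleOf (S.filtration p (p + q))

instance (p q : ℕ) : AddCommGroup (S.E0 p q) := inferInstanceAs (AddCommGroup (_ ⧸ _))

instance (p q : ℕ) : Module ℝ (S.E0 p q) := inferInstanceAs (Module ℝ (_ ⧸ _))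

/-- The quotient map `F^p Ω^{p+q} → E_0^{p,q}`. -/
def E0.mk (p q : ℕ) : S.filtration p (p + q) →ₗ[ℝ] S.E0 p q := Submodule.mkQ _

/-- The differential `E_{l,0}^{p,q} → E_{l,0}^{p,q+1}` induced by `d_l`. -/
def d0 (l : ℤ) (p q : ℕ) : S.E0 p q →ₗ[ℝ] S.E0 p (q + 1) :=
  Submodule.mapQ _ _ ((S.d l (p + q)).restrict (S.d_mem_filtration p l (p + q)))
    fun a ha => S.d_mem_filtration (p + 1) l (p + q) a ha

/-- The term `E_{l,1}^{p,q}` of the spectral sequence of the complex `(Ω^*, d_l)` filtered by `F`. -/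
abbrev E1 (l : ℤ) (p q : ℕ) : Type _ := Cohomology (S.d0 l p) q

/-- The Lichnerowicz–Novikov cohomology `H^j_l = H^j(Ω^*, d_l)`. -/
abbrev H (l : ℤ) (j : ℕ) : Type _ := Cohomology (S.d l) j

/-- `L^p : Ω^j → Ω^m` where `m = j + 2p`. -/
def LpowTo (p j m : ℕ) (h : j + 2 * p = m) : DiffForm E M j →ₗ[ℝ] DiffForm E M m :=
  castDeg h ∘ₗ S.Lpow p j

theorem LpowTo_succ (p j m : ℕ) (h : j + 2 * p = m) (h' : j + 2 * (p + 1) = m + 2)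
    (α : DiffForm E M j) : S.LpowTo (p + 1) j (m + 2) h' α = S.L m (S.LpowTo p j m h α) := by
  subst h; rfl

theorem LpowTo_mem (p : ℕ) : ∀ (j m : ℕ) (h : j + 2 * p = m) (α : DiffForm E M j),
    S.LpowTo p j m h α ∈ S.filtration p m := by
  induction p with
  | zero => exact fun j m h α => Submodule.mem_top
  | succ p ih =>
    rintro j _ rfl α
    change S.LpowTo (p + 1) j (j + 2 * p + 2) rfl α ∈ S.filtration (p + 1) (j + 2 * p + 2)
    rw [S.LpowTo_succ p j (j + 2 * p) rfl rfl]
    exact ⟨_, ih j _ rfl α, rfl⟩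

theorem d_LpowTo (l : ℤ) (p : ℕ) : ∀ (j m : ℕ) (h : j + 2 * p = m) (h' : j + 1 + 2 * p = m + 1)
    (α : DiffForm E M j),
    S.d (l + p) m (S.LpowTo p j m h α) = S.LpowTo p (j + 1) (m + 1) h' (S.d l j α) := by
  induction p with
  | zero =>
    rintro j _ rfl h' α
    simp only [Nat.cast_zero, add_zero]
    rfl
  | succ p ih =>
    rintro j _ rfl h' α
    have h2 : j + 1 + 2 * p = j + 2 * p + 1 := by omega
    refine Eq.trans ?_ (S.LpowTo_succ p (j + 1) (j + 2 * p + 1) h2 h' _).symm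
    refine Eq.trans (congrArg _ (S.LpowTo_succ p j (j + 2 * p) rfl rfl α)) ?_
    refine (S.d_L _ _ _).trans ?_
    rw [← ih j _ rfl h2, Nat.cast_succ, ← add_assoc, add_sub_cancel_right]
    rfl

/-- The map `Ω^j → E_0^{p,p+j}`, `β ↦ [L^p β]`. -/
def toE0 (p j : ℕ) : DiffForm E M j →ₗ[ℝ] S.E0 p (p + j) :=
  E0.mk S p (p + j) ∘ₗ (S.LpowTo p j (p + (p + j)) (by omega)).codRestrict _ (S.LpowTo_mem p j _ _)

theorem d0_toE0 (l : ℤ) (p j : ℕ) (α : DiffForm E M j) :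
    S.d0 (l + p) p (p + j) (S.toE0 p j α) = S.toE0 p (j + 1) (S.d l j α) := by
  refine congrArg (E0.mk S p (p + (j + 1))) (Subtype.ext ?_)
  exact S.d_LpowTo l p j (p + (p + j)) (by omega) (by omega) α

/-- The map `H^j_{l-1} → H^{j+2}_l`, `[η] ↦ [L η]`. -/
def Lbar (l : ℤ) (j : ℕ) : S.H (l - 1) j →ₗ[ℝ] S.H l (j + 2) :=
  Cohomology.map (S.d (l - 1)) (S.d l) (S.L j)
    (fun a ha => by
      rw [LinearMap.mem_ker] at ha ⊢
      rw [S.d_L, ha, map_zero])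
    (fun a ha => by
      match j, a, ha with
      | 0, a, ha => rw [(Submodule.mem_bot ℝ).1 ha, map_zero]; exact zero_mem _
      | j + 1, _, ⟨b, rfl⟩ => exact ⟨S.L j b, S.d_L l j b⟩)

/-- The map `H^j_l → E_{l+p,1}^{p,p+j}`, `[β] ↦ [L^p β]`. -/
def LbarP (l : ℤ) (p j : ℕ) : S.H l j →ₗ[ℝ] S.E1 (l + p) p (p + j) :=
  Cohomology.map (S.d l) (S.d0 (l + p) p) (S.toE0 p j)
    (fun a ha => by
      rw [LinearMap.mem_ker] at ha ⊢
      rw [S.d0_toE0, ha, map_zero])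
    (fun a ha => by
      match j, a, ha with
      | 0, a, ha => rw [(Submodule.mem_bot ℝ).1 ha, map_zero]; exact zero_mem _
      | j + 1, _, ⟨b, rfl⟩ => exact ⟨S.toE0 p j b, S.d0_toE0 l p j b⟩)

/-- `δ : E_{l+p,1}^{p,p+j+1} → H^j_{l-1}` is the connecting homomorphism: every cocycle of
`E_0^{p,p+j+1}` can be written `[L^p α]` with `d_l α = L η` and `d_{l-1} η = 0`, and for every such
choice of `α` and `η` the map `δ` sends its class to `[η]`. -/
def IsConnecting (l : ℤ) (p j : ℕ) (δ : S.E1 (l + p) p (p + (j + 1)) →ₗ[ℝ] S.H (l - 1) j) :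
    Prop :=
  ∀ z : LinearMap.ker (S.d0 (l + p) p (p + (j + 1))),
    (∃ (α : DiffForm E M (j + 1)) (η : LinearMap.ker (S.d (l - 1) j)),
      (z : S.E0 p (p + (j + 1))) = S.toE0 p (j + 1) α ∧ S.d l (j + 1) α = S.L j η) ∧
    ∀ (α : DiffForm E M (j + 1)) (η : LinearMap.ker (S.d (l - 1) j)),
      (z : S.E0 p (p + (j + 1))) = S.toE0 p (j + 1) α → S.d l (j + 1) α = S.L j η →
        δ (Cohomology.mk (S.d0 (l + p) p) (p + (j + 1)) z) = Cohomology.mk (S.d (l - 1)) j η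

/-- The primitive `k`-forms on a manifold of dimension `2n`: the kernel of `L^{n-k+1}` if `k ≤ n`,
and zero if `k > n`. -/
def primitive (n k : ℕ) : Submodule ℝ (DiffForm E M k) :=
  if k ≤ n then LinearMap.ker (S.Lpow (n - k + 1) k) else ⊥

open Classical in
/-- The projection `Ω^k → P^k` along `L Ω^{k-2}`, when `Ω^k` is the direct sum of the two. -/
def primProj (n k : ℕ) : DiffForm E M k →ₗ[ℝ] S.primitive n k :=
  if h : IsCompl (S.primitive n k) (S.filtration 1 k) then Submodule.projectionOnto _ _ h else 0

/-- The operator `d_l^+ : P^j → P^{j+1}`, which is `d_l` followed by the projection to `P^{j+1}`. -/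
def dplus (n : ℕ) (l : ℤ) (j : ℕ) : S.primitive n j →ₗ[ℝ] S.primitive n (j + 1) :=
  S.primProj n (j + 1) ∘ₗ S.d l j ∘ₗ (S.primitive n j).subtype

end LCSStructure
end
end LCS

end

open LCS

/-! The core is hard Lefschetz for a nondegenerate 2-form on a vector space of dimension 2n. Wedging
with ω, contraction with the dual bivector and the weight n - degree form an sl₂-triple, so
`sl2_pow_injective` makes L^p injective in degrees j ≤ n - p. Exchanging the raising and lowering
operators gives the opposite injection, and comparing dimensions makes L^q bijective from degree n -
q to degree n + q. Both facts pass to smooth forms, because inverting an invertible operator is a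
smooth operation (`Lpow_injective`, `Lpow_surjective`). The splitting (1) follows.

Write q = p + j. As d_{l+p} L^p = L^p d_l, the map β ↦ [L^p β] is a chain map from Ω^j to
E_0^{p,p+j}. It is always onto, and for j + p ≤ n its kernel is L Ω^{j-2} (`toE0_eq_zero_iff`). In
this range E_0^{p,p+j} is therefore Ω^j / L Ω^{j-2}. Every class there has a unique primitive
representative, which turns d_0 into d_l^+; this is (2).

For (3), L is injective on Ω^j for j < n, so in low degrees there is a short exact sequence of
complexes from (Ω^{*-2}, d_{l-1}) by L to (Ω^*, d_l) and on to E_0^{p,p+*}. The sequence of (3) is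
its long exact sequence. Since exactness only holds in a range of degrees, each diagram chase is
done by hand with the degree bound it needs. The connecting map comes from the linear relation
between [L^p α] and [η] given by d_l α = L η. -/

open LCS

/-! ### Representations of sl₂ with nilpotent lowering operator. -/

section Sl2
variable {A : Type*} [AddCommGroup A] [Module ℝ A]

/-- Moving Λ past each factor of L contributes one weight, and m + (m - 2) + ... + (m - 2p) = (p +
1)(m - p). -/
theorem sl2_comm_pow {L Λ D : A →ₗ[ℝ] A} (hΛL : ∀ a, Λ (L a) = L (Λ a) + D a)
    (hDL : ∀ a, D (L a) = L (D a) - (2 : ℝ) • L a) {a : A} {m : ℝ} (ha : D a = m • a) (p : ℕ) :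
    D ((L ^ p) a) = (m - 2 * p) • (L ^ p) a ∧
    Λ ((L ^ (p + 1)) a) = (L ^ (p + 1)) (Λ a) + ((p + 1) * (m - p)) • (L ^ p) a := by
  have hD : ∀ p : ℕ, D ((L ^ p) a) = (m - 2 * p) • (L ^ p) a := by
    intro p
    induction p with
    | zero => simp [ha]
    | succ p ih =>
      rw [pow_succ', Module.End.mul_apply, hDL, ih, map_smul]
      push_cast
      module
  refine ⟨hD p, ?_⟩
  induction p with
  | zero => simp [hΛL, ha]
  | succ p ih =>
    rw [pow_succ' L (p + 1), Module.End.mul_apply, hΛL, ih, hD, map_add, map_smul,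
      Module.End.mul_apply, ← Module.End.mul_apply L (L ^ p), ← pow_succ']
    push_cast
    module

/-- In an `sl₂`-module in which `Λ` is nilpotent, `L ^ p` is injective on the vectors of weight
at least `p`. -/
theorem sl2_pow_injective {L Λ D : A →ₗ[ℝ] A} (hΛL : ∀ a, Λ (L a) = L (Λ a) + D a)
    (hDL : ∀ a, D (L a) = L (D a) - (2 : ℝ) • L a)
    (hDΛ : ∀ a, D (Λ a) = Λ (D a) + (2 : ℝ) • Λ a) (N : ℕ) :
    ∀ (p : ℕ) (m : ℝ) (a : A), (Λ ^ N) a = 0 → D a = m • a → p ≤ m → (L ^ p) a = 0 → a = 0 := by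
  -- The outer induction is on the nilpotency order of Λ at `a`, the inner one on p. No
  -- decomposition into primitive vectors is needed.
  induction N with
  | zero => exact fun p m a h _ _ _ => by simpa using h
  | succ N ihN =>
    intro p
    induction p with
    | zero => exact fun m a _ _ _ h => by simpa using h
    | succ p ihp =>
      intro m a hN ha hp h
      push_cast at hp
      obtain ⟨-, h1⟩ := sl2_comm_pow hΛL hDL ha p
      rw [h, map_zero] at h1
      have h2 : (L ^ (p + 1 + 1)) (Λ a) = 0 := by
        have := congrArg L h1
        rw [map_zero, map_add, map_smul, ← Module.End.mul_apply L, ← Module.End.mul_apply L,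
          ← pow_succ', ← pow_succ', h, smul_zero, add_zero] at this
        exact this.symm
      -- Λ a has weight m + 2 and a smaller nilpotency order, and p + 2 ≤ m + 2, so the outer
      -- hypothesis applies. Then (p + 1)(m - p) L^p a = 0 with a nonzero coefficient.
      have h3 : Λ a = 0 := by
        refine ihN (p + 1 + 1) (m + 2) (Λ a) ?_ ?_ ?_ h2
        · rw [← Module.End.mul_apply, ← pow_succ, hN]
        · rw [hDΛ, ha, map_smul]; module
        · push_cast; linarith
      rw [h3, map_zero, zero_add] at h1
      have h4 : ((p + 1 : ℝ) * (m - p)) ≠ 0 := by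
        have : (0 : ℝ) < m - p := by linarith
        positivity
      exact ihp m a hN ha (by linarith) ((smul_eq_zero.1 h1.symm).resolve_left h4)
end Sl2

/-! ### Interior products of wedge products on a normed space. -/

section Pointwise
open ContinuousAlternatingMap
variable {E : Type*} [NormedAddCommGroup E] [NormedSpace ℝ E] {k : ℕ}

theorem vecCons_removeNth_succ {X : Type*} {m : ℕ} (v : X) (u : Fin (m + 1) → X) (i : Fin (m + 1)) :
    i.succ.removeNth (Matrix.vecCons v u) = Matrix.vecCons v (i.removeNth u) := by
  ext j
  refine Fin.cases ?_ (fun j => ?_) j <;> simp [Fin.removeNth]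

/-- `curryLeft v` is the interior product ι_v, and this is its antiderivation rule: the term of
index 0 is the one in which θ receives v. Degree 0 is separate because ι_v α does not exist there.
-/
theorem wedgeOne_curryLeft (θ : Alt E 1) (α : Alt E (k + 1)) (v : E) :
    (wedgeOne θ α).curryLeft v = θ ![v] • α - wedgeOne θ (α.curryLeft v) := by
  ext u
  refine (wedgeOne_apply θ α (Matrix.vecCons v u)).trans ?_
  have h : wedgeOne θ (α.curryLeft v) u = _ := wedgeOne_apply θ (α.curryLeft v) u
  rw [ContinuousAlternatingMap.sub_apply, ContinuousAlternatingMap.smul_apply, h,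
    Fin.sum_univ_succ, sub_eq_add_neg, ← Finset.sum_neg_distrib]
  refine congrArg₂ (· + ·) (by simp [Fin.removeNth_zero]) (Finset.sum_congr rfl fun i _ => ?_)
  rw [vecCons_removeNth_succ]
  simp [pow_succ]

theorem wedgeOne_curryLeft_zero (θ : Alt E 1) (α : Alt E 0) (v : E) :
    (wedgeOne θ α).curryLeft v = θ ![v] • α := by
  ext u
  refine (wedgeOne_apply θ α (Matrix.vecCons v u)).trans ?_
  rw [Fin.sum_univ_one]
  simp [Fin.removeNth_zero]

theorem wedgeTwo_curryLeft_zero (σ : Alt E 2) (α : Alt E 0) (v : E) :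
    (wedgeTwo σ α).curryLeft v = wedgeOne (σ.curryLeft v) α := by
  ext u
  refine (wedgeTwo_apply σ α (Matrix.vecCons v u)).trans
    (Eq.trans ?_ (wedgeOne_apply (σ.curryLeft v) α u).symm)
  rw [Fin.sum_univ_one, Fin.sum_univ_one, show Finset.Ici (0 : Fin 1) = {0} by decide,
    Finset.sum_singleton]
  rfl

/-- In the shuffle sum, the terms with i = 0 feed v to σ and the others feed it to α. No sign
appears since σ has even degree. -/
theorem wedgeTwo_curryLeft (σ : Alt E 2) (α : Alt E (k + 1)) (v : E) :
    (wedgeTwo σ α).curryLeft v =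
      wedgeTwo σ (α.curryLeft v) + wedgeOne (σ.curryLeft v) α := by
  ext u
  refine (wedgeTwo_apply σ α (Matrix.vecCons v u)).trans ?_
  have h1 : wedgeOne (σ.curryLeft v) α u = _ := wedgeOne_apply (σ.curryLeft v) α u
  have h2 : wedgeTwo σ (α.curryLeft v) u = _ := wedgeTwo_apply σ (α.curryLeft v) u
  rw [ContinuousAlternatingMap.add_apply, h1, h2, Fin.sum_univ_succ, add_comm]
  refine congrArg₂ (· + ·) (Finset.sum_congr rfl fun i _ => ?_) ?_
  · have hI : Finset.Ici i.succ = (Finset.Ici i).map (Fin.succEmb (k + 1)) := by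
      ext j
      refine Fin.cases ?_ (fun j => ?_) j <;> simp
    rw [hI, Finset.sum_map]
    refine Finset.sum_congr rfl fun j _ => ?_
    rw [Fin.coe_succEmb, Fin.castSucc_succ, vecCons_removeNth_succ, vecCons_removeNth_succ]
    simp [pow_succ, pow_add]
  · have hI : Finset.Ici (0 : Fin (k + 2)) = Finset.univ := by ext; simp
    rw [hI]
    refine Finset.sum_congr rfl fun i _ => ?_
    simp [Fin.removeNth_zero]

/-- `∑ fᵢ ∧ ι(bᵢ) α = k α` if `∑ fᵢ(v) bᵢ = v` for all `v`. -/
theorem sum_wedgeOne_curryLeft {ι : Type*} [Fintype ι] (f : ι → Alt E 1) (b : ι → E)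
    (h : ∀ v, ∑ i, f i ![v] • b i = v) (α : Alt E (k + 1)) :
    ∑ i, wedgeOne (f i) (α.curryLeft (b i)) = ((k : ℝ) + 1) • α := by
  -- Completeness of `f`, `b` reassembles α from its interior products; alternating the curried form
  -- then multiplies α by its degree k + 1.
  have h1 : ∑ i, (oneForm (f i)).smulRight (α.curryLeft (b i)) = α.curryLeft := by
    ext v : 1
    conv_rhs => rw [← h v]
    simp [oneForm_apply]
  have h2 : ∑ i, wedgeOne (f i) (α.curryLeft (b i)) =
      alternatizeUncurryFinCLM ℝ E ℝ (∑ i, (oneForm (f i)).smulRight (α.curryLeft (b i))) := by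
    rw [_root_.map_sum]; rfl
  rw [h2, h1, alternatizeUncurryFinCLM_apply, alternatizeUncurryFin_curryLeft]
  rw [← Nat.cast_smul_eq_nsmul ℝ]; push_cast; rfl
end Pointwise

/-! ### Contraction with the dual bivector and its commutator with σ ∧. -/

section Lefschetz
open ContinuousAlternatingMap
variable {E : Type*} [NormedAddCommGroup E] [NormedSpace ℝ E] {k : ℕ}

theorem neg_swap_two (σ : Alt E 2) (x y : E) : σ ![x, y] = - σ ![y, x] := by
  have h0 : σ (![y, x] ∘ Equiv.swap (0 : Fin 2) 1) = - σ ![y, x] :=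
    σ.toAlternatingMap.map_swap ![y, x] (i := 0) (j := 1) (by decide)
  rw [← h0]; congr 1; ext i; fin_cases i <;> rfl

/-- Nondegeneracy of a `2`-form on a vector space. -/
def Nondeg (σ : Alt E 2) : Prop := ∀ v, (∀ w, σ ![v, w] = 0) → v = 0

theorem curryLeft_apply_one (σ : Alt E 2) (v w : E) : σ.curryLeft v ![w] = σ ![v, w] := rfl

/-- Any basis e serves, not only a Darboux basis: w_i is the vector with σ(w_i, ·) equal to the i-th
coordinate. The first two identities resolve the identity map, and the third is a trace. -/
theorem Nondeg.exists_dual [FiniteDimensional ℝ E] {σ : Alt E 2} (h : Nondeg σ) :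
    ∃ (e w : Fin (Module.finrank ℝ E) → E), (∀ v, ∑ i, σ.curryLeft (w i) ![v] • e i = v) ∧
      (∀ v, ∑ i, (-σ.curryLeft (e i)) ![v] • w i = v) ∧
      ∑ i, σ.curryLeft (e i) ![w i] = -(Module.finrank ℝ E : ℝ) := by
  let b := Module.finBasis ℝ E
  let B : E →ₗ[ℝ] Module.Dual ℝ E :=
    { toFun := fun v => (oneForm (σ.curryLeft v)).toLinearMap
      map_add' := fun x y => by
        ext v
        simp [oneForm_apply]
      map_smul' := fun c y => by
        ext v
        simp [oneForm_apply] }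
  have hB : ∀ v w, B v w = σ ![v, w] := fun v w => oneForm_apply (σ.curryLeft v) w
  have hinj : Function.Injective B := by
    refine (injective_iff_map_eq_zero B).2 fun v hv => h v fun w => ?_
    rw [← hB, hv]; rfl
  have hsurj : Function.Surjective B :=
    (LinearMap.injective_iff_surjective_of_finrank_eq_finrank
      (Subspace.dual_finrank_eq).symm).1 hinj
  choose w hw using fun i => hsurj (b.coord i)
  have hw' : ∀ i v, σ ![w i, v] = b.repr v i := fun i v => by rw [← hB, hw]; rfl
  refine ⟨b, w, fun v => ?_, fun v => hinj ?_, ?_⟩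
  · simp only [curryLeft_apply_one, hw', b.sum_repr]
  · ext u
    have hu := congrArg (B v) (b.sum_repr u)
    rw [_root_.map_sum] at hu
    rw [← hu]
    simp only [_root_.map_sum, LinearMap.map_smul, LinearMap.sum_apply, LinearMap.smul_apply, hB,
      hw']
    refine Finset.sum_congr rfl fun i _ => ?_
    rw [← hB, LinearMap.map_smul, hB, neg_swap_two σ v]
    exact mul_comm _ _
  · simp only [curryLeft_apply_one]
    rw [Finset.sum_congr rfl fun i _ => (neg_swap_two σ (b i) (w i)).trans
      (congrArg Neg.neg (hw' i (b i)))]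
    simp

variable {ι : Type*} [Fintype ι]

/-- Contraction with the bivector `-1/2 ∑ eᵢ ∧ wᵢ`. -/
noncomputable def contract (e w : ι → E) (j : ℕ) : Alt E (j + 2) →ₗ[ℝ] Alt E j where
  toFun α := (-2⁻¹ : ℝ) • ∑ i, (α.curryLeft (e i)).curryLeft (w i)
  map_add' α β := by
    simp only [curryLeft_add, _root_.add_apply, Finset.sum_add_distrib, smul_add]
  map_smul' c α := by
    simp only [curryLeft_smul, _root_.smul_apply, ← Finset.smul_sum, RingHom.id_apply]
    exact smul_comm _ _ _

theorem contract_apply (e w : ι → E) (j : ℕ) (α : Alt E (j + 2)) :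
    contract e w j α = (-2⁻¹ : ℝ) • ∑ i, (α.curryLeft (e i)).curryLeft (w i) := rfl

/-- `α ↦ σ ∧ α` as a linear map. -/
noncomputable def wedgeTwoLin (σ : Alt E 2) (j : ℕ) : Alt E j →ₗ[ℝ] Alt E (j + 2) :=
  ((wedgeTwoL j).flip σ).toLinearMap

theorem wedgeTwoLin_apply (σ : Alt E 2) (α : Alt E k) : wedgeTwoLin σ k α = wedgeTwo σ α := rfl

variable {σ : Alt E 2} {e w : ι → E} {n : ℝ}

theorem wedgeOne_neg_left (θ : Alt E 1) (α : Alt E k) : wedgeOne (-θ) α = - wedgeOne θ α := by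
  simp only [← wedgeOneL_apply, map_neg, _root_.neg_apply]

theorem contract_wedgeTwo_zero (h3 : ∑ i, σ.curryLeft (e i) ![w i] = -(2 * n)) (α : Alt E 0) :
    contract e w 0 (wedgeTwo σ α) = n • α := by
  have h : ∀ i, ((wedgeTwo σ α).curryLeft (e i)).curryLeft (w i) = σ.curryLeft (e i) ![w i] • α :=
    fun i => (congrArg (fun β : Alt E 1 => β.curryLeft (w i))
      (wedgeTwo_curryLeft_zero σ α (e i))).trans (wedgeOne_curryLeft_zero _ _ _)
  rw [contract_apply, Finset.sum_congr rfl fun i _ => h i, ← Finset.sum_smul, h3]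
  module

theorem contract_wedgeTwo_one (h1 : ∀ v, ∑ i, σ.curryLeft (w i) ![v] • e i = v)
    (h2 : ∀ v, ∑ i, (-σ.curryLeft (e i)) ![v] • w i = v)
    (h3 : ∑ i, σ.curryLeft (e i) ![w i] = -(2 * n)) (α : Alt E 1) :
    contract e w 1 (wedgeTwo σ α) = (n - 1) • α := by
  have e1 := sum_wedgeOne_curryLeft _ _ h1 α
  have e2 := sum_wedgeOne_curryLeft _ _ h2 α
  simp only [wedgeOne_neg_left, Finset.sum_neg_distrib] at e2
  simp only [contract_apply, wedgeTwo_curryLeft, curryLeft_add, _root_.add_apply,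
    wedgeTwo_curryLeft_zero, wedgeOne_curryLeft, Finset.sum_add_distrib, Finset.sum_sub_distrib,
    ← Finset.sum_smul]
  rw [h3, e1, neg_eq_iff_eq_neg.1 e2]
  push_cast
  module

/-- This is the relation [Λ, L] = n - degree. Applying the Leibniz rules twice leaves two cross
terms, each summing to (j + 2) α by completeness, and the trace term -2n α; the factor -1/2 turns
these into n - (j + 2). Degrees 0 and 1 have fewer terms and are treated above. -/
theorem contract_wedgeTwo (h1 : ∀ v, ∑ i, σ.curryLeft (w i) ![v] • e i = v)
    (h2 : ∀ v, ∑ i, (-σ.curryLeft (e i)) ![v] • w i = v)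
    (h3 : ∑ i, σ.curryLeft (e i) ![w i] = -(2 * n)) (j : ℕ) (α : Alt E (j + 2)) :
    contract e w (j + 2) (wedgeTwo σ α) =
      wedgeTwo σ (contract e w j α) + (n - (j + 2 : ℕ)) • α := by
  have e1 := sum_wedgeOne_curryLeft (k := j + 1) _ _ h1 α
  have e2 := sum_wedgeOne_curryLeft (k := j + 1) _ _ h2 α
  simp only [wedgeOne_neg_left, Finset.sum_neg_distrib] at e2
  have e3 : wedgeTwo σ (contract e w j α) =
      (-2⁻¹ : ℝ) • ∑ i, wedgeTwo σ ((α.curryLeft (e i)).curryLeft (w i)) := by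
    rw [← wedgeTwoLin_apply, contract_apply, map_smul, _root_.map_sum]; rfl
  rw [e3, contract_apply]
  simp only [wedgeTwo_curryLeft, curryLeft_add, _root_.add_apply,
    wedgeOne_curryLeft, Finset.sum_add_distrib, Finset.sum_sub_distrib,
    ← Finset.sum_smul]
  rw [h3, e1, neg_eq_iff_eq_neg.1 e2]
  push_cast
  module
end Lefschetz

/-! ### Families of forms of all degrees as one sl₂-module; hard Lefschetz. -/

section LefschetzTotal
variable {E : Type*} [NormedAddCommGroup E] [NormedSpace ℝ E] {k : ℕ}
variable {ι : Type*} [Fintype ι]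

/-- The operator `L` on families of forms of all degrees. -/
noncomputable def totL (σ : Alt E 2) : (∀ j, Alt E j) →ₗ[ℝ] (∀ j, Alt E j) :=
  LinearMap.pi fun
    | 0 => 0
    | 1 => 0
    | j + 2 => wedgeTwoLin σ j ∘ₗ LinearMap.proj j

/-- The contraction on families of forms of all degrees. -/
noncomputable def totContract (e w : ι → E) : (∀ j, Alt E j) →ₗ[ℝ] (∀ j, Alt E j) :=
  LinearMap.pi fun j => contract e w j ∘ₗ LinearMap.proj (j + 2)

/-- The weight operator, which is `n - j` in degree `j`. -/
noncomputable def totWeight (n : ℝ) : (∀ j, Alt E j) →ₗ[ℝ] (∀ j, Alt E j) :=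
  LinearMap.pi fun j => (n - j) • LinearMap.proj j

theorem totWeight_apply (n : ℝ) (a : ∀ j, Alt E j) (j : ℕ) : totWeight n a j = (n - j) • a j := rfl

theorem totContract_apply (e w : ι → E) (a : ∀ j, Alt E j) (j : ℕ) :
    totContract e w a j = contract e w j (a (j + 2)) := rfl

theorem totL_apply (σ : Alt E 2) (a : ∀ j, Alt E j) (j : ℕ) :
    totL σ a (j + 2) = wedgeTwo σ (a j) := rfl

theorem totL_single (σ : Alt E 2) (j : ℕ) (α : Alt E j) :
    totL σ (Pi.single j α) = Pi.single (j + 2) (wedgeTwo σ α) := by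
  funext m
  match m with
  | 0 =>
    symm
    apply Pi.single_eq_of_ne
    omega
  | 1 =>
    symm
    apply Pi.single_eq_of_ne
    omega
  | m + 2 =>
    rw [totL_apply]
    by_cases h : m = j
    · subst h; simp
    · rw [Pi.single_eq_of_ne h, Pi.single_eq_of_ne (by omega), ← wedgeTwoLin_apply, map_zero]

theorem totContract_single (e w : ι → E) (j : ℕ) (α : Alt E (j + 2)) :
    totContract e w (Pi.single (j + 2) α) = Pi.single j (contract e w j α) := by
  funext m
  rw [totContract_apply]
  by_cases h : m = j
  · subst h; simp
  · rw [Pi.single_eq_of_ne h, Pi.single_eq_of_ne (by omega), map_zero]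

theorem totWeight_single (n : ℝ) (j : ℕ) (α : Alt E j) :
    totWeight n (Pi.single j α) = (n - j) • Pi.single j α := by
  funext m
  rw [totWeight_apply, Pi.smul_apply]
  by_cases h : m = j
  · subst h; rfl
  · rw [Pi.single_eq_of_ne h, smul_zero, smul_zero]

/-- The `p`-th power of `α ↦ σ ∧ α`. -/
noncomputable def wedgePow (σ : Alt E 2) : ∀ p j : ℕ, Alt E j →ₗ[ℝ] Alt E (j + 2 * p)
  | 0, _ => LinearMap.id
  | p + 1, j => wedgeTwoLin σ (j + 2 * p) ∘ₗ wedgePow σ p j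

/-- The `p`-th power of the contraction. -/
noncomputable def contractPow (e w : ι → E) : ∀ p j : ℕ, Alt E (j + 2 * p) →ₗ[ℝ] Alt E j
  | 0, _ => LinearMap.id
  | p + 1, j => contractPow e w p j ∘ₗ contract e w (j + 2 * p)

/-- The sl₂ lemmas need endomorphisms of one module; this translates their conclusions back to a
fixed degree. -/
theorem totL_pow_single (σ : Alt E 2) (p j : ℕ) (α : Alt E j) :
    (totL σ ^ p) (Pi.single j α) = Pi.single (j + 2 * p) (wedgePow σ p j α) := by
  induction p with
  | zero => rfl
  | succ p ih => rw [pow_succ', Module.End.mul_apply, ih, totL_single]; rfl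

theorem totContract_pow_single (e w : ι → E) (p j : ℕ) (α : Alt E (j + 2 * p)) :
    (totContract e w ^ p) (Pi.single (j + 2 * p) α) = Pi.single j (contractPow e w p j α) := by
  induction p with
  | zero => rfl
  | succ p ih =>
    rw [pow_succ, Module.End.mul_apply]
    exact (congrArg _ (totContract_single e w (j + 2 * p) α)).trans (ih _)

instance finiteDimensional_alt [FiniteDimensional ℝ E] : FiniteDimensional ℝ (Alt E k) := by
  let f : Alt E k →ₗ[ℝ] MultilinearMap ℝ (fun _ : Fin k => E) ℝ :=
    { toFun := fun α => α.toAlternatingMap.toMultilinearMap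
      map_add' := fun _ _ => rfl
      map_smul' := fun _ _ => rfl }
  refine FiniteDimensional.of_injective f fun α β h => ?_
  ext v
  exact congrArg (fun g : MultilinearMap ℝ (fun _ : Fin k => E) ℝ => g v) h

theorem alt_eq_zero_of_finrank_lt [FiniteDimensional ℝ E] (h : Module.finrank ℝ E < k)
    (α : Alt E k) : α = 0 := by
  ext v
  refine α.toAlternatingMap.map_linearDependent v fun hv => ?_
  have := hv.fintype_card_le_finrank
  simp at this
  omega

/-- The N-th power vanishes in degrees below 2N because nothing lies in negative degree, and in the
other degrees because these exceed the dimension. -/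
theorem totL_pow_eq_zero [FiniteDimensional ℝ E] (σ : Alt E 2) {N : ℕ}
    (hN : Module.finrank ℝ E < 2 * N) (a : ∀ j, Alt E j) : (totL σ ^ N) a = 0 := by
  have h : ∀ N j, j < 2 * N → (totL σ ^ N) a j = 0 := by
    intro N
    induction N with
    | zero => intro j hj; omega
    | succ N ih =>
      intro j hj
      rw [pow_succ', Module.End.mul_apply]
      match j with
      | 0 => rfl
      | 1 => rfl
      | j + 2 => rw [totL_apply, ih j (by omega), ← wedgeTwoLin_apply, map_zero]
  funext j
  by_cases hj : j < 2 * N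
  · exact h N j hj
  · exact alt_eq_zero_of_finrank_lt (by omega) _

theorem totContract_pow_eq_zero [FiniteDimensional ℝ E] (e w : ι → E) {N : ℕ}
    (hN : Module.finrank ℝ E < 2 * N) (a : ∀ j, Alt E j) : (totContract e w ^ N) a = 0 := by
  have h : ∀ N j, Module.finrank ℝ E < j + 2 * N → (totContract e w ^ N) a j = 0 := by
    intro N
    induction N with
    | zero => intro j hj; exact alt_eq_zero_of_finrank_lt (by omega) _
    | succ N ih =>
      intro j hj
      rw [pow_succ', Module.End.mul_apply, totContract_apply, ih (j + 2) (by omega), map_zero]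
  funext j
  exact h N j (by omega)

theorem totContract_totL {σ : Alt E 2} {e w : ι → E} {n : ℝ}
    (h1 : ∀ v, ∑ i, σ.curryLeft (w i) ![v] • e i = v)
    (h2 : ∀ v, ∑ i, (-σ.curryLeft (e i)) ![v] • w i = v)
    (h3 : ∑ i, σ.curryLeft (e i) ![w i] = -(2 * n)) (a : ∀ j, Alt E j) :
    totContract e w (totL σ a) = totL σ (totContract e w a) + totWeight n a := by
  funext j
  rw [totContract_apply, totL_apply, Pi.add_apply, totWeight_apply]
  match j with
  | 0 =>
    refine (contract_wedgeTwo_zero h3 _).trans ?_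
    rw [Nat.cast_zero, sub_zero]
    exact (zero_add _).symm
  | 1 =>
    refine (contract_wedgeTwo_one h1 h2 h3 _).trans ?_
    rw [Nat.cast_one]
    exact (zero_add _).symm
  | j + 2 => exact contract_wedgeTwo h1 h2 h3 j _

theorem totWeight_totL (σ : Alt E 2) (n : ℝ) (a : ∀ j, Alt E j) :
    totWeight n (totL σ a) = totL σ (totWeight n a) - (2 : ℝ) • totL σ a := by
  funext j
  rw [totWeight_apply, Pi.sub_apply, Pi.smul_apply]
  match j with
  | 0 => exact (smul_zero _).trans (by simp [totL])
  | 1 => exact (smul_zero _).trans (by simp [totL])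
  | j + 2 =>
    rw [totL_apply, totL_apply, totWeight_apply, ← wedgeTwoLin_apply, ← wedgeTwoLin_apply, map_smul]
    push_cast
    module

theorem totWeight_totContract (e w : ι → E) (n : ℝ) (a : ∀ j, Alt E j) :
    totWeight n (totContract e w a) =
      totContract e w (totWeight n a) + (2 : ℝ) • totContract e w a := by
  funext j
  rw [totWeight_apply, Pi.add_apply, Pi.smul_apply, totContract_apply, totContract_apply,
    totWeight_apply, map_smul]
  push_cast
  module

variable [FiniteDimensional ℝ E] {σ : Alt E 2} {n : ℕ}

/-- `σ^p ∧` is injective on forms of degree `j ≤ n - p`. -/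
theorem Nondeg.wedgePow_injective (h : Nondeg σ) (hn : Module.finrank ℝ E = 2 * n) {p j : ℕ}
    (hp : j + p ≤ n) : Function.Injective (wedgePow σ p j) := by
  obtain ⟨e, w, h1, h2, h3⟩ := h.exists_dual
  replace h3 := h3.trans (show _ = -(2 * (n : ℝ)) by rw [hn]; push_cast; rfl)
  refine (injective_iff_map_eq_zero _).2 fun α hα => ?_
  -- A form of degree j has weight n - j ≥ p, and n + 1 contractions kill everything because 2(n +
  -- 1) exceeds the dimension 2n.
  have := sl2_pow_injective (totContract_totL h1 h2 h3) (totWeight_totL σ n)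
    (totWeight_totContract e w n) (n + 1) p (n - j) (Pi.single j α)
    (totContract_pow_eq_zero e w (by omega) _) (totWeight_single _ _ _) (by
      rw [le_sub_iff_add_le']; exact_mod_cast hp) (by rw [totL_pow_single, hα, Pi.single_zero])
  exact Pi.single_eq_zero_iff.1 this

/-- Hard Lefschetz: `σ^q ∧` is an isomorphism from degree `n - q` to degree `n + q`. -/
theorem Nondeg.wedgePow_bijective (h : Nondeg σ) (hn : Module.finrank ℝ E = 2 * n) {q j : ℕ}
    (hq : j + q = n) : Function.Bijective (wedgePow σ q j) := by
  have hinj := h.wedgePow_injective hn hq.le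
  obtain ⟨e, w, h1, h2, h3⟩ := h.exists_dual
  replace h3 := h3.trans (show _ = -(2 * (n : ℝ)) by rw [hn]; push_cast; rfl)
  -- The triple (Λ, L, -D) satisfies the same relations. For it, degree j + 2q = n + q has weight q,
  -- so Λ^q is injective from there; the two injections force equal dimensions.
  have hc : Function.Injective (contractPow e w q j) := by
    refine (injective_iff_map_eq_zero _).2 fun α hα => ?_
    have := sl2_pow_injective (L := totContract e w) (Λ := totL σ) (D := -totWeight (n : ℝ))
      (fun a => by rw [totContract_totL h1 h2 h3 a]; simp)
      (fun a => by
        rw [LinearMap.neg_apply, totWeight_totContract, LinearMap.neg_apply, map_neg]; abel)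
      (fun a => by
        rw [LinearMap.neg_apply, totWeight_totL, LinearMap.neg_apply, map_neg]; abel)
      (n + 1) q q (Pi.single (j + 2 * q) α)
      (totL_pow_eq_zero σ (by omega) _) (by
        rw [LinearMap.neg_apply, totWeight_single, ← neg_smul, ← hq]
        congr 1
        push_cast
        ring) le_rfl (by rw [totContract_pow_single, hα, Pi.single_zero])
    exact Pi.single_eq_zero_iff.1 this
  exact ⟨hinj, (LinearMap.injective_iff_surjective_of_finrank_eq_finrank
    (le_antisymm (LinearMap.finrank_le_finrank_of_injective hinj)
      (LinearMap.finrank_le_finrank_of_injective hc))).1 hinj⟩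
end LefschetzTotal

/-! ### Naturality and smooth dependence of the powers; the differential of θ ∧ α. -/

section PointwisePower
open ContinuousAlternatingMap
variable {E : Type*} [NormedAddCommGroup E] [NormedSpace ℝ E] {k : ℕ}

theorem wedgePow_comp (σ : Alt E 2) (g : E →L[ℝ] E) (p j : ℕ) (α : Alt E j) :
    wedgePow (σ.compContinuousLinearMap g) p j (α.compContinuousLinearMap g) =
      (wedgePow σ p j α).compContinuousLinearMap g := by
  induction p with
  | zero => rfl
  | succ p ih =>
    refine (congrArg (wedgeTwoLin (σ.compContinuousLinearMap g) (j + 2 * p)) ih).trans ?_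
    exact wedgeTwo_comp σ _ g

/-- The `p`-th power of `α ↦ σ ∧ α` as a continuous linear map. -/
noncomputable def wedgePowL (σ : Alt E 2) : ∀ p j : ℕ, Alt E j →L[ℝ] Alt E (j + 2 * p)
  | 0, _ => ContinuousLinearMap.id ℝ _
  | p + 1, j => (wedgeTwoL (j + 2 * p)).flip σ ∘L wedgePowL σ p j

theorem wedgePowL_apply (σ : Alt E 2) (p j : ℕ) (α : Alt E j) :
    wedgePowL σ p j α = wedgePow σ p j α := by
  induction p with
  | zero => rfl
  | succ p ih => exact congrArg (wedgeTwoLin σ (j + 2 * p)) ih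

theorem contDiff_wedgePowL (p j : ℕ) : ContDiff ℝ ∞ fun σ : Alt E 2 => wedgePowL σ p j := by
  induction p with
  | zero => exact contDiff_const
  | succ p ih => exact (ContinuousLinearMap.contDiff _).clm_comp ih

theorem Nondeg.comp [FiniteDimensional ℝ E] {σ : Alt E 2} (h : Nondeg σ) {g : E →L[ℝ] E}
    (hg : Function.Surjective g) : Nondeg (σ.compContinuousLinearMap g) := by
  intro v hv
  have hinj : Function.Injective g :=
    (LinearMap.injective_iff_surjective (f := g.toLinearMap)).2 hg
  refine hinj ?_
  rw [_root_.map_zero]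
  refine h _ fun w => ?_
  obtain ⟨w, rfl⟩ := hg w
  rw [← hv w, compContinuousLinearMap_apply]
  congr 1
  ext i
  fin_cases i <;> rfl

/-- Invertibility as a continuous operator is what makes the inverse depend smoothly on σ, as
`Lpow_surjective` requires. -/
theorem Nondeg.wedgePowL_isInvertible [FiniteDimensional ℝ E] {σ : Alt E 2} (h : Nondeg σ) {n : ℕ}
    (hn : Module.finrank ℝ E = 2 * n) {q j : ℕ} (hq : j + q = n) :
    (wedgePowL σ q j).IsInvertible := by
  have hb : Function.Bijective (wedgePowL σ q j) := by
    have := h.wedgePow_bijective hn hq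
    rwa [show ⇑(wedgePow σ q j) = wedgePowL σ q j from
      funext fun α => (wedgePowL_apply σ q j α).symm] at this
  exact ⟨(LinearEquiv.ofBijective (wedgePowL σ q j).toLinearMap hb).toContinuousLinearEquiv,
    ContinuousLinearMap.ext fun _ => rfl⟩

/-- The double alternation is applied to (u, v) ↦ θ(u) θ(v) α, which is symmetric. -/
theorem wedgeOne_wedgeOne_self (θ : Alt E 1) (α : Alt E k) : wedgeOne θ (wedgeOne θ α) = 0 := by
  have h := alt_smulRight_swap (oneForm θ) ((oneForm θ).smulRight α)
  rw [alternatizeUncurryFin_alternatizeUncurryFinCLM_comp_of_symmetric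
    (by intro x y; simp [smul_smul, mul_comm])] at h
  exact neg_eq_zero.1 h.symm

/-- Of the two terms of the product rule, the one with Dθ is symmetric by closedness and alternates
to zero; the other acquires its sign when the two arguments are swapped. -/
theorem extDeriv_wedgeOne {θ : E → Alt E 1} {α : E → Alt E k} {y : E}
    (hθ : DifferentiableAt ℝ θ y) (hα : DifferentiableAt ℝ α y) (hd : extDeriv θ y = 0) :
    extDeriv (fun z => wedgeOne (θ z) (α z)) y = - wedgeOne (θ y) (extDeriv α y) := by
  have h := ((wedgeOneL (E := E) k).hasFDerivAt.comp y hθ.hasFDerivAt).clm_apply hα.hasFDerivAt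
  have h' : fderiv ℝ (fun z => wedgeOne (θ z) (α z)) y = _ := h.fderiv
  rw [extDeriv, h', alternatizeUncurryFin_add]
  have hs : ∀ u v, fderiv ℝ θ y u ![v] = fderiv ℝ θ y v ![u] := by
    intro u v
    have h0 : ∑ i : Fin 2, (-1) ^ (i : ℕ) • fderiv ℝ θ y (![u, v] i) (i.removeNth ![u, v]) = 0 :=
      (alternatizeUncurryFin_apply (fderiv ℝ θ y) ![u, v]).symm.trans
        (congrArg (fun f : Alt E 2 => f ![u, v]) hd)
    have e0 : (0 : Fin 2).removeNth ![u, v] = ![v] := by ext i; fin_cases i; rfl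
    have e1 : (1 : Fin 2).removeNth ![u, v] = ![u] := by ext i; fin_cases i; rfl
    rw [Fin.sum_univ_two, e0, e1] at h0
    simpa [← sub_eq_add_neg, sub_eq_zero] using h0
  have h1 : alternatizeUncurryFin (((wedgeOneL (E := E) k).comp (fderiv ℝ θ y)).flip (α y)) = 0 := by
    let B : E →L[ℝ] E →L[ℝ] Alt E k :=
      (ContinuousLinearMap.smulRightL ℝ E (Alt E k)).flip (α y) ∘L
        ((ofSubsingletonLIE (𝕜 := ℝ) (E := E) (F := ℝ) (0 : Fin 1)).symm :
          Alt E 1 →L[ℝ] E →L[ℝ] ℝ) ∘L fderiv ℝ θ y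
    refine alternatizeUncurryFin_alternatizeUncurryFinCLM_comp_of_symmetric (f := B) fun u v => ?_
    have hB : ∀ u v, B u v = fderiv ℝ θ y u ![v] • α y := fun u v => by
      rw [← oneForm_apply]; rfl
    rw [hB, hB, hs]
  have h2 := alt_smulRight_swap (oneForm (θ y)) (fderiv ℝ α y)
  refine Eq.trans ?_ h2
  refine Eq.trans ?_ (add_zero _)
  exact congrArg₂ (· + ·) rfl h1
end PointwisePower

/-! ### d_l² = 0, and hard Lefschetz for smooth forms. -/

namespace LCS.LCSStructure
variable {E : Type*} [NormedAddCommGroup E] [NormedSpace ℝ E]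
  {M : Type*} [TopologicalSpace M] [ChartedSpace E M] [IsManifold 𝓘(ℝ, E) ∞ M]

theorem extD_extD {k : ℕ} (α : DiffForm E M k) : extD (k + 1) (extD k α) = 0 := by
  refine DiffForm.ext_inChart fun x => ?_
  have hx := mem_extChartAt_target (I := 𝓘(ℝ, E)) x
  refine (inChart_extD (extD k α) x hx).trans ?_
  -- Equality is needed on a neighbourhood, because the expression is differentiated again.
  have h : inChart (extD k α) x =ᶠ[𝓝 (extChartAt 𝓘(ℝ, E) x x)] extDeriv (inChart α x) := by
    filter_upwards [(isOpen_extChartAt_target (I := 𝓘(ℝ, E)) x).mem_nhds hx] with y hy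
    exact inChart_extD α x hy
  have hr : minSmoothness ℝ 2 ≤ (∞ : WithTop ℕ∞) := by
    rw [minSmoothness_of_isRCLikeNormedField]; exact ENat.LEInfty.out
  rw [h.extDeriv_eq]
  exact extDeriv_extDeriv_apply (α.contDiffAt_inChart x hx) hr

theorem extD_wedge1 {θ : DiffForm E M 1} (hθ : extD 1 θ = 0) {k : ℕ} (α : DiffForm E M k) :
    extD (k + 1) (θ.wedge1 k α) = - θ.wedge1 (k + 1) (extD k α) := by
  refine DiffForm.ext_inChart fun x => ?_
  set y := extChartAt 𝓘(ℝ, E) x x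
  have hx : y ∈ (extChartAt 𝓘(ℝ, E) x).target := mem_extChartAt_target (I := 𝓘(ℝ, E)) x
  have hd : extDeriv (inChart θ x) y = 0 := by
    rw [← inChart_extD θ x hx, hθ]; rfl
  refine (inChart_extD _ x hx).trans ?_
  have e : inChart (θ.wedge1 k α) x = fun z => wedgeOne (inChart θ x z) (inChart α x z) :=
    funext fun z => inChart_wedge1 _ _ _ _
  rw [e, extDeriv_wedgeOne ((θ.contDiffAt_inChart x hx).differentiableAt (by norm_num))
    ((α.contDiffAt_inChart x hx).differentiableAt (by norm_num)) hd]
  refine Eq.trans ?_ (congrArg Neg.neg (inChart_wedge1 θ (extD k α) x y).symm)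
  rw [inChart_extD _ x hx]

variable (S : LCSStructure E M)

/-- The cross terms cancel because θ is closed, and the quadratic term vanishes because θ ∧ θ = 0.
-/
theorem d_d (l : ℤ) (j : ℕ) (α : DiffForm E M j) : S.d l (j + 1) (S.d l j α) = 0 := by
  have h : S.theta.wedge1 (j + 1) (S.theta.wedge1 j α) = 0 :=
    DiffForm.ext fun x => wedgeOne_wedgeOne_self (E := E) (S.theta x) (α x)
  simp only [d, LinearMap.add_apply, LinearMap.smul_apply, map_add, map_smul, extD_extD,
    extD_wedge1 S.d_theta, h]
  module

theorem Lpow_apply (p j : ℕ) (α : DiffForm E M j) (x : M) :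
    S.Lpow p j α x = wedgePow (E := E) (S.omega x) p j (α x) := by
  induction p with
  | zero => rfl
  | succ p ih => exact congrArg (wedgeTwoLin (E := E) (S.omega x) (j + 2 * p)) ih

theorem nondeg (x : M) : Nondeg (E := E) (S.omega x) := S.nondegenerate x

variable [FiniteDimensional ℝ E] {n : ℕ}

theorem nondeg_inChart (x₀ : M) {y : E} (hy : y ∈ (extChartAt 𝓘(ℝ, E) x₀).target) :
    Nondeg (inChart S.omega x₀ y) := by
  have hI : IsManifold 𝓘(ℝ, E) 1 M := IsManifold.of_le (n := ∞) (by norm_num)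
  refine Nondeg.comp (E := E) (S.nondeg ((extChartAt 𝓘(ℝ, E) x₀).symm y)) ?_
  have h3 := mfderivWithin_extChartAt_symm_comp_mfderiv_extChartAt' (I := 𝓘(ℝ, E))
    ((extChartAt 𝓘(ℝ, E) x₀).map_target hy)
  simp only [modelWithCornersSelf_coe, Set.range_id, mfderivWithin_univ] at h3
  rw [(extChartAt 𝓘(ℝ, E) x₀).right_inv hy] at h3
  intro v
  exact ⟨_, congrArg (fun f : E →L[ℝ] E => f v) h3⟩

theorem Lpow_injective (hn : Module.finrank ℝ E = 2 * n) {p j : ℕ} (hp : j + p ≤ n) :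
    Function.Injective (S.Lpow p j) := fun α β h => DiffForm.ext fun x =>
  (S.nondeg x).wedgePow_injective hn hp <| by
    have := congrArg (fun γ : DiffForm E M (j + 2 * p) => γ x) h
    simp only [Lpow_apply] at this
    exact this

/-- The equation is solved point by point; in a chart the solution is the inverse of a smooth family
of invertible operators applied to a smooth form, hence smooth. -/
theorem Lpow_surjective (hn : Module.finrank ℝ E = 2 * n) {q j : ℕ} (hq : j + q = n) :
    Function.Surjective (S.Lpow q j) := by
  intro γ
  choose β hβ using fun x : M => ((S.nondeg x).wedgePow_bijective hn hq).2 (γ x)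
  have hβ' : ∀ x₀ y, wedgePow (inChart S.omega x₀ y) q j (inChart (β : RawForm E M j) x₀ y) =
      inChart γ x₀ y := fun x₀ y => by
    refine (wedgePow_comp (E := E) _ _ q j _).trans ?_
    exact congrArg (fun α : Alt E (j + 2 * q) => α.compContinuousLinearMap _) (hβ _)
  refine ⟨DiffForm.mkOf (β : RawForm E M j) fun x₀ => ?_,
    DiffForm.ext fun x => (S.Lpow_apply q j _ x).trans (hβ x)⟩
  have hx := mem_extChartAt_target (I := 𝓘(ℝ, E)) x₀
  have h : ContDiffAt ℝ ∞ (fun y => (wedgePowL (inChart S.omega x₀ y) q j).inverse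
      (inChart γ x₀ y)) (extChartAt 𝓘(ℝ, E) x₀ x₀) := by
    refine ContDiffAt.clm_apply ?_ (γ.contDiffAt_inChart x₀ hx)
    refine ContDiffAt.comp (g := ContinuousLinearMap.inverse)
      (f := fun y => wedgePowL (inChart S.omega x₀ y) q j) _ ?_ ?_
    · exact ((S.nondeg_inChart x₀ hx).wedgePowL_isInvertible hn hq).contDiffAt_map_inverse
    · exact (contDiff_wedgePowL (E := E) q j).contDiffAt.comp _ (S.omega.contDiffAt_inChart x₀ hx)
  refine h.congr_of_eventuallyEq ?_
  filter_upwards [(isOpen_extChartAt_target (I := 𝓘(ℝ, E)) x₀).mem_nhds hx] with y hy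
  obtain ⟨e, he⟩ := (S.nondeg_inChart x₀ hy).wedgePowL_isInvertible hn hq
  rw [← he, ContinuousLinearMap.inverse_equiv]
  refine (e.symm_apply_eq.2 ?_).symm
  rw [← hβ', ← wedgePowL_apply, ← he]
  rfl

theorem diffForm_eq_zero (hn : Module.finrank ℝ E = 2 * n) {k : ℕ} (hk : 2 * n < k)
    (α : DiffForm E M k) : α = 0 :=
  DiffForm.ext fun x => alt_eq_zero_of_finrank_lt (E := E) (by omega) (α x)
end LCS.LCSStructure

/-! ### Linear algebra of cohomology classes and relations. -/

section Cohomology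
variable {V W : ℕ → Type*} [∀ j, AddCommGroup (V j)] [∀ j, Module ℝ (V j)]
  [∀ j, AddCommGroup (W j)] [∀ j, Module ℝ (W j)]

theorem cohomologyMk_surjective (d : ∀ j, V j →ₗ[ℝ] V (j + 1)) (j : ℕ) :
    Function.Surjective (Cohomology.mk d j) := Submodule.mkQ_surjective _

theorem cohomologyMk_eq_zero_iff (d : ∀ j, V j →ₗ[ℝ] V (j + 1)) {j : ℕ} (z : LinearMap.ker (d j)) :
    Cohomology.mk d j z = 0 ↔ (z : V j) ∈ coboundaries d j :=
  Submodule.Quotient.mk_eq_zero _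

theorem cohomologyMap_injective {d : ∀ j, V j →ₗ[ℝ] V (j + 1)} {e : ∀ j, W j →ₗ[ℝ] W (j + 1)}
    {i j : ℕ} (f : V i →ₗ[ℝ] W j) (hker : ∀ a ∈ LinearMap.ker (d i), f a ∈ LinearMap.ker (e j))
    (hcob : ∀ a ∈ coboundaries d i, f a ∈ coboundaries e j)
    (h : ∀ a ∈ LinearMap.ker (d i), f a ∈ coboundaries e j → a ∈ coboundaries d i) :
    Function.Injective (Cohomology.map d e f hker hcob) := by
  refine (injective_iff_map_eq_zero _).2 fun x hx => ?_
  obtain ⟨a, rfl⟩ := cohomologyMk_surjective d i x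
  exact (cohomologyMk_eq_zero_iff d a).2
    (h a a.2 ((cohomologyMk_eq_zero_iff e ⟨f a, hker a a.2⟩).1 hx))

theorem cohomologyMap_surjective {d : ∀ j, V j →ₗ[ℝ] V (j + 1)} {e : ∀ j, W j →ₗ[ℝ] W (j + 1)}
    {i j : ℕ} (f : V i →ₗ[ℝ] W j) (hker : ∀ a ∈ LinearMap.ker (d i), f a ∈ LinearMap.ker (e j))
    (hcob : ∀ a ∈ coboundaries d i, f a ∈ coboundaries e j)
    (h : ∀ b ∈ LinearMap.ker (e j), ∃ a ∈ LinearMap.ker (d i), f a = b) :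
    Function.Surjective (Cohomology.map d e f hker hcob) := by
  intro y
  obtain ⟨b, rfl⟩ := cohomologyMk_surjective e j y
  obtain ⟨a, ha, hab⟩ := h b b.2
  exact ⟨Cohomology.mk d i ⟨a, ha⟩, congrArg (Cohomology.mk e j) (Subtype.ext hab)⟩

/-- A total linear relation which is single-valued at `0` is the graph of a linear map. -/
theorem exists_linearMap_of_relation {A B : Type*} [AddCommGroup A] [Module ℝ A] [AddCommGroup B]
    [Module ℝ B] (R : Submodule ℝ (A × B)) (total : ∀ a, ∃ b, (a, b) ∈ R)
    (zero : ∀ b, ((0 : A), b) ∈ R → b = 0) : ∃ f : A →ₗ[ℝ] B, ∀ a b, (a, b) ∈ R → f a = b := by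
  have huniq : ∀ a b b', (a, b) ∈ R → (a, b') ∈ R → b = b' := fun a b b' h h' =>
    sub_eq_zero.1 (zero _ (by simpa using R.sub_mem h h'))
  choose f hf using total
  exact ⟨{ toFun := f
           map_add' := fun a b => huniq _ _ _ (hf _) (R.add_mem (hf a) (hf b))
           map_smul' := fun c a => huniq _ _ _ (hf _) (R.smul_mem c (hf a)) },
    fun a b h => huniq _ _ _ (hf a) h⟩
end Cohomology

/-! ### The filtration, E_0 and E_1. -/

namespace LCS.LCSStructure
variable {E : Type*} [NormedAddCommGroup E] [NormedSpace ℝ E]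
  {M : Type*} [TopologicalSpace M] [ChartedSpace E M] [IsManifold 𝓘(ℝ, E) ∞ M]
  (S : LCSStructure E M)

/-- `Lpow` adds new factors on the outside, so absorbing an innermost L takes an induction. -/
theorem LpowTo_L (p : ℕ) : ∀ (j m : ℕ) (h : j + 2 + 2 * p = m) (h' : j + 2 * (p + 1) = m)
    (α : DiffForm E M j), S.LpowTo p (j + 2) m h (S.L j α) = S.LpowTo (p + 1) j m h' α := by
  induction p with
  | zero =>
    rintro j _ rfl h' α
    rfl
  | succ p ih =>
    rintro j _ rfl h' α
    refine (S.LpowTo_succ p (j + 2) (j + 2 + 2 * p) rfl rfl _).trans ?_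
    refine Eq.trans ?_ (S.LpowTo_succ (p + 1) j (j + 2 + 2 * p) (by omega) h' α).symm
    rw [ih j _ rfl (by omega)]

theorem exists_LpowTo_eq (p : ℕ) : ∀ (j m : ℕ) (h : j + 2 * p = m) (α : DiffForm E M m),
    α ∈ S.filtration p m → ∃ β, S.LpowTo p j m h β = α := by
  induction p with
  | zero =>
    rintro j _ rfl α -
    exact ⟨α, rfl⟩
  | succ p ih =>
    rintro j _ rfl _ ⟨γ, hγ, rfl⟩
    obtain ⟨β, rfl⟩ := ih j (j + 2 * p) rfl γ hγ
    exact ⟨β, S.LpowTo_succ p j (j + 2 * p) rfl rfl β⟩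

theorem filtration_eq_bot (p : ℕ) : ∀ m, m < 2 * p → S.filtration p m = ⊥ := by
  induction p with
  | zero => intro m h; omega
  | succ p ih =>
    intro m h
    match m with
    | 0 => rfl
    | 1 => rfl
    | m + 2 =>
      have := ih m (by omega)
      rw [filtration, this, Submodule.map_bot]

theorem mem_filtration_one_iff (j : ℕ) (α : DiffForm E M (j + 2)) :
    α ∈ S.filtration 1 (j + 2) ↔ ∃ β, S.L j β = α :=
  ⟨fun ⟨β, _, h⟩ => ⟨β, h⟩, fun ⟨β, h⟩ => ⟨β, Submodule.mem_top, h⟩⟩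

theorem toE0_surjective (p j : ℕ) : Function.Surjective (S.toE0 p j) := by
  intro x
  obtain ⟨⟨α, hα⟩, rfl⟩ : ∃ y, E0.mk S p (p + j) y = x := Submodule.mkQ_surjective _ x
  obtain ⟨β, rfl⟩ := S.exists_LpowTo_eq p j (p + (p + j)) (by omega) α hα
  exact ⟨β, rfl⟩

theorem toE0_eq_zero_iff_mem (p j : ℕ) (α : DiffForm E M j) :
    S.toE0 p j α = 0 ↔
      S.LpowTo p j (p + (p + j)) (by omega) α ∈ S.filtration (p + 1) (p + (p + j)) :=
  Submodule.Quotient.mk_eq_zero _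

theorem toE0_eq_zero {p j : ℕ} {α : DiffForm E M j} (h : α ∈ S.filtration 1 j) :
    S.toE0 p j α = 0 := by
  match j, α, h with
  | 0, α, h => rw [(Submodule.mem_bot ℝ).1 h, map_zero]
  | 1, α, h => rw [(Submodule.mem_bot ℝ).1 h, map_zero]
  | j + 2, _, ⟨β, _, rfl⟩ =>
    rw [toE0_eq_zero_iff_mem, S.LpowTo_L p j _ _ (by omega)]
    exact S.LpowTo_mem _ _ _ _ _

/-- Coboundaries of E_0 lift to genuine coboundaries of forms, with no bound on the degree, since β
↦ [L^p β] is onto and commutes with the differentials. -/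
theorem mem_coboundaries_E0_iff (l : ℤ) (p j : ℕ) (z : S.E0 p (p + j)) :
    z ∈ coboundaries (S.d0 (l + p) p) (p + j) ↔
      ∃ β ∈ coboundaries (S.d l) j, S.toE0 p j β = z := by
  match j, z with
  | j + 1, z =>
    constructor
    · rintro ⟨y, rfl⟩
      obtain ⟨γ, rfl⟩ := S.toE0_surjective p j y
      exact ⟨_, ⟨γ, rfl⟩, (S.d0_toE0 l p j γ).symm⟩
    · rintro ⟨_, ⟨γ, rfl⟩, rfl⟩
      exact ⟨S.toE0 p j γ, S.d0_toE0 l p j γ⟩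
  | 0, z =>
    constructor
    · intro hz
      refine ⟨0, zero_mem _, ?_⟩
      rw [map_zero]
      -- For j = 0 and positive filtration index, the incoming term is a quotient of some F^r
      -- Ω^{2r-1}, which is zero; for index 0 there is no incoming term.
      match p, z, hz with
      | 0, z, hz => exact ((Submodule.mem_bot ℝ).1 hz).symm
      | p + 1, _, ⟨y, rfl⟩ =>
        obtain ⟨⟨α, hα⟩, rfl⟩ : ∃ x, E0.mk S (p + 1) p x = y := Submodule.mkQ_surjective _ y
        rw [S.filtration_eq_bot (p + 1) _ (by omega), Submodule.mem_bot] at hα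
        subst hα
        exact (map_zero ((S.d0 _ (p + 1) p) ∘ₗ E0.mk S (p + 1) p)).symm
    · rintro ⟨β, hβ, rfl⟩
      rw [(Submodule.mem_bot ℝ).1 hβ, map_zero]
      exact zero_mem _

variable {S} in
-- If L η = d_l α, then L^p α is a cocycle of E_0 whose class δ sends to [η]. Injectivity of L plays
-- no role at this spot.
theorem IsConnecting.exact_right {l : ℤ} {p j : ℕ}
    {δ : S.E1 (l + p) p (p + (j + 1)) →ₗ[ℝ] S.H (l - 1) j} (hδ : S.IsConnecting l p j δ) :
    Function.Exact δ (S.Lbar l j) := by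
  intro x
  constructor
  · intro hx
    obtain ⟨η, rfl⟩ := cohomologyMk_surjective _ _ x
    obtain ⟨α, hα⟩ := (cohomologyMk_eq_zero_iff (S.d l) (j := j + 2) _).1 hx
    refine ⟨Cohomology.mk _ _ ⟨S.toE0 p (j + 1) α, ?_⟩, (hδ _).2 α η rfl hα⟩
    rw [LinearMap.mem_ker, d0_toE0]
    exact S.toE0_eq_zero (p := p) ((S.mem_filtration_one_iff j _).2 ⟨η, hα.symm⟩)
  · rintro ⟨y, rfl⟩
    obtain ⟨z, rfl⟩ := cohomologyMk_surjective _ _ y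
    obtain ⟨⟨α, η, h1, h2⟩, h3⟩ := hδ z
    rw [h3 α η h1 h2]
    exact (cohomologyMk_eq_zero_iff (S.d l) (j := j + 2) _).2 ⟨α, h2⟩

variable [FiniteDimensional ℝ E] {n : ℕ}

theorem LpowTo_injective (hn : Module.finrank ℝ E = 2 * n)
    {p j m : ℕ} (h : j + 2 * p = m) (hp : j + p ≤ n) :
    Function.Injective (S.LpowTo p j m h) := by
  subst h
  exact S.Lpow_injective hn hp

theorem L_injective (hn : Module.finrank ℝ E = 2 * n)
    {j : ℕ} (hj : j + 1 ≤ n) : Function.Injective (S.L j) :=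
  S.Lpow_injective hn (p := 1) hj

/-- If L^p α = L^{p+1} γ, cancelling L^p gives α = L γ. In degrees j < 2 the step F^{p+1} vanishes,
so α = 0. -/
theorem toE0_eq_zero_iff (hn : Module.finrank ℝ E = 2 * n)
    {p j : ℕ} (hp : j + p ≤ n) (α : DiffForm E M j) :
    S.toE0 p j α = 0 ↔ α ∈ S.filtration 1 j := by
  refine ⟨fun h => ?_, S.toE0_eq_zero⟩
  rw [toE0_eq_zero_iff_mem] at h
  have h0 : j < 2 → α = 0 := fun hj => by
    rw [S.filtration_eq_bot (p + 1) _ (by omega), Submodule.mem_bot] at h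
    exact S.LpowTo_injective hn _ hp (h.trans (map_zero _).symm)
  match j, α, h, h0 with
  | 0, α, h, h0 => rw [h0 (by omega)]; exact zero_mem _
  | 1, α, h, h0 => rw [h0 (by omega)]; exact zero_mem _
  | j + 2, α, h, h0 =>
    obtain ⟨γ, hγ⟩ := S.exists_LpowTo_eq (p + 1) j _ (by omega) _ h
    rw [← S.LpowTo_L p j _ (by omega)] at hγ
    exact (S.mem_filtration_one_iff j α).2 ⟨γ, S.LpowTo_injective hn _ hp hγ⟩

/-- With r = n - k + 1, the map L^{r+1} on Ω^{k-2} is bijective by hard Lefschetz. Solving L^{r+1} β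
= L^r α makes α - L β primitive, and injectivity makes the sum direct. -/
theorem isCompl_primitive (hn : Module.finrank ℝ E = 2 * n)
    {k : ℕ} (hk : k ≤ n) : IsCompl (S.primitive n k) (S.filtration 1 k) := by
  rw [primitive, if_pos hk]
  -- For k = 0, 1 the target degree 2n - k + 2 exceeds 2n, so every form is primitive.
  have htop : k < 2 → LinearMap.ker (S.Lpow (n - k + 1) k) = ⊤ := fun h =>
    eq_top_iff.2 fun α _ => diffForm_eq_zero hn (by omega) _
  match k, hk, htop with
  | 0, _, htop => rw [htop (by omega)]; exact isCompl_top_bot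
  | 1, _, htop => rw [htop (by omega)]; exact isCompl_top_bot
  | k + 2, hk, _ =>
    have hL : ∀ β, S.Lpow (n - (k + 2) + 1) (k + 2) (S.L k β) =
        S.LpowTo (n - (k + 2) + 1 + 1) k _ (by omega) β :=
      fun β => S.LpowTo_L (n - (k + 2) + 1) k (k + 2 + 2 * (n - (k + 2) + 1)) rfl (by omega) β
    refine ⟨Submodule.disjoint_def.2 ?_, Submodule.codisjoint_iff_exists_add_eq.2 fun α => ?_⟩
    · rintro _ hα ⟨β, -, rfl⟩
      rw [LinearMap.mem_ker, hL] at hα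
      rw [S.LpowTo_injective hn _ (by omega) (hα.trans (map_zero _).symm), map_zero]
    · have hs : Function.Surjective (S.LpowTo (n - (k + 2) + 1 + 1) k
          (k + 2 + 2 * (n - (k + 2) + 1)) (by omega)) := by
        have : ∀ m h, Function.Surjective (S.LpowTo (n - (k + 2) + 1 + 1) k m h) := by
          rintro _ rfl
          exact S.Lpow_surjective hn (by omega)
        exact this _ _
      obtain ⟨β, hβ⟩ := hs (S.Lpow (n - (k + 2) + 1) (k + 2) α)
      refine ⟨α - S.L k β, S.L k β, ?_, ⟨β, Submodule.mem_top, rfl⟩, sub_add_cancel _ _⟩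
      rw [LinearMap.mem_ker, map_sub, hL, hβ, sub_self]

theorem sub_primProj_mem (hn : Module.finrank ℝ E = 2 * n)
    {k : ℕ} (hk : k ≤ n) (α : DiffForm E M k) :
    α - S.primProj n k α ∈ S.filtration 1 k := by
  have h := S.isCompl_primitive hn hk
  rw [primProj, dif_pos h, ← Submodule.projectionOnto_apply_eq_zero_iff h, map_sub,
    Submodule.projectionOnto_apply_left, sub_self]

theorem toE0_primitive_bijective (hn : Module.finrank ℝ E = 2 * n) {p j : ℕ} (hp : j + p ≤ n) :
    Function.Bijective (S.toE0 p j ∘ₗ (S.primitive n j).subtype) := by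
  have hc := S.isCompl_primitive hn (show j ≤ n by omega)
  constructor
  · refine (injective_iff_map_eq_zero _).2 fun a ha => Subtype.ext ?_
    exact Submodule.disjoint_def.1 hc.disjoint a a.2 ((S.toE0_eq_zero_iff hn hp _).1 ha)
  · intro z
    obtain ⟨α, rfl⟩ := S.toE0_surjective p j z
    refine ⟨S.primProj n j α, ?_⟩
    have := S.toE0_eq_zero (p := p) (S.sub_primProj_mem hn (show j ≤ n by omega) α)
    rw [map_sub, sub_eq_zero] at this
    exact this.symm

/-- Projecting d_l a to primitive forms discards only an element of F^1, which is invisible in E_0.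
-/
theorem d0_toE0_primitive (hn : Module.finrank ℝ E = 2 * n)
    (l : ℤ) {p j : ℕ} (hj : j + 1 ≤ n) (a : S.primitive n j) :
    S.d0 (l + p) p (p + j) (S.toE0 p j a) = S.toE0 p (j + 1) (S.dplus n l j a) := by
  rw [d0_toE0]
  have := S.toE0_eq_zero (p := p) (S.sub_primProj_mem hn hj (S.d l j a))
  rw [map_sub, sub_eq_zero] at this
  exact this

/-- Primitive forms and E_0 agree in degrees up to n - p, compatibly with d_l^+ and d_0. The bound p
+ j + 1 ≤ n includes degree j + 1, which the cocycle condition needs. -/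
theorem exists_primitive_equiv (hn : Module.finrank ℝ E = 2 * n)
    (l : ℤ) {p j : ℕ} (hp : p + j + 1 ≤ n) :
    ∃ Φ : Cohomology (S.dplus n l) j ≃ₗ[ℝ] S.E1 (l + p) p (p + j),
      ∀ a : LinearMap.ker (S.dplus n l j),
        ∃ z : LinearMap.ker (S.d0 (l + p) p (p + j)),
          (z : S.E0 p (p + j)) = S.toE0 p j a ∧
          Φ (Cohomology.mk (S.dplus n l) j a) = Cohomology.mk (S.d0 (l + p) p) (p + j) z := by
  set f := S.toE0 p j ∘ₗ (S.primitive n j).subtype with hf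
  have hb := S.toE0_primitive_bijective hn (show j + p ≤ n by omega)
  have hb' := S.toE0_primitive_bijective hn (show j + 1 + p ≤ n by omega)
  have hkey : ∀ a, f a ∈ LinearMap.ker (S.d0 (l + p) p (p + j)) ↔
      a ∈ LinearMap.ker (S.dplus n l j) := fun a => by
    rw [LinearMap.mem_ker, LinearMap.mem_ker]
    refine Iff.trans ?_ (map_eq_zero_iff _ hb'.1)
    exact Eq.congr_left (S.d0_toE0_primitive hn l (by omega) a)
  have hcob : ∀ a, f a ∈ coboundaries (S.d0 (l + p) p) (p + j) ↔
      a ∈ coboundaries (S.dplus n l) j := by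
    match j, hp, f, hf, hb with
    | 0, hp, f, hf, hb =>
      intro a
      rw [mem_coboundaries_E0_iff]
      constructor
      · rintro ⟨β, hβ, h⟩
        rw [(Submodule.mem_bot ℝ).1 hβ, map_zero] at h
        exact (Submodule.mem_bot ℝ).2 (hb.1 ((by rw [← hf, ← h] : _ = (0 : S.E0 p (p + 0))).trans
          (map_zero _).symm))
      · intro ha
        rw [(Submodule.mem_bot ℝ).1 ha, map_zero]
        exact ⟨0, zero_mem _, map_zero _⟩
    | j + 1, hp, f, hf, hb =>
      intro a
      have hb0 := S.toE0_primitive_bijective hn (show j + p ≤ n by omega)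
      constructor
      · rintro ⟨y, hy⟩
        obtain ⟨c, rfl⟩ := hb0.2 y
        refine ⟨c, hb.1 ?_⟩
        exact (S.d0_toE0_primitive hn l (by omega) c).symm.trans (hy.trans (by rw [hf]))
      · rintro ⟨c, rfl⟩
        refine ⟨S.toE0 p j c, ?_⟩
        rw [hf]
        exact S.d0_toE0_primitive hn l (by omega) c
  refine ⟨LinearEquiv.ofBijective (Cohomology.map (S.dplus n l) (S.d0 (l + p) p) f
    (fun a ha => (hkey a).2 ha) (fun a ha => (hcob a).2 ha))
    ⟨cohomologyMap_injective _ _ _ fun a _ h => (hcob a).1 h,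
      cohomologyMap_surjective _ _ _ fun b hb'' => ?_⟩, fun a => ?_⟩
  · obtain ⟨a, rfl⟩ := hb.2 b
    exact ⟨a, (hkey a).1 hb'', rfl⟩
  · exact ⟨⟨f a, (hkey a).2 a.2⟩, rfl, rfl⟩

/-- In degrees 0 and 1 there is nothing of the form L η to divide by, so cocycles of E_0^{p,p} are
closed functions. This is the segment 0 → H^0 → E^{p,p} → 0. -/
theorem LbarP_zero_bijective (hn : Module.finrank ℝ E = 2 * n) (l : ℤ) {p : ℕ} (hp : p + 1 ≤ n) :
    Function.Bijective (S.LbarP l p 0) := by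
  refine ⟨cohomologyMap_injective _ _ _ fun a _ h => ?_,
    cohomologyMap_surjective _ _ _ fun z hz => ?_⟩
  · obtain ⟨β, hβ, h⟩ := (S.mem_coboundaries_E0_iff l p 0 _).1 h
    rw [(Submodule.mem_bot ℝ).1 hβ, map_zero] at h
    exact (S.toE0_eq_zero_iff hn (by omega) a).1 h.symm
  · obtain ⟨a, rfl⟩ := S.toE0_surjective p 0 z
    refine ⟨a, ?_, rfl⟩
    have h := (S.d0_toE0 l p 0 a).symm.trans hz
    exact (S.toE0_eq_zero_iff hn (by omega) _).1 h

theorem LbarP_one_injective (hn : Module.finrank ℝ E = 2 * n) (l : ℤ) {p : ℕ} (hp : p + 1 ≤ n) :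
    Function.Injective (S.LbarP l p 1) := by
  refine cohomologyMap_injective _ _ _ fun a _ h => ?_
  obtain ⟨β, hβ, h⟩ := (S.mem_coboundaries_E0_iff l p 1 _).1 h
  have h1 : S.toE0 p 1 (β - a) = 0 := by rw [map_sub, h, sub_self]
  rw [S.toE0_eq_zero_iff hn (by omega)] at h1
  rwa [← sub_eq_zero.1 ((Submodule.mem_bot ℝ).1 h1)]

/-- A cocycle [L^p α] has d_l α = L η for some η. Then L d_{l-1} η = d_l d_l α = 0, and L is
injective in degree j + 1, so η is closed. -/
theorem exists_connecting_pair (hn : Module.finrank ℝ E = 2 * n)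
    (l : ℤ) {p j : ℕ} (hp : p + j + 2 ≤ n) (z : S.E0 p (p + (j + 1)))
    (hz : z ∈ LinearMap.ker (S.d0 (l + p) p (p + (j + 1)))) :
    ∃ (α : DiffForm E M (j + 1)) (η : LinearMap.ker (S.d (l - 1) j)),
      z = S.toE0 p (j + 1) α ∧ S.d l (j + 1) α = S.L j η := by
  obtain ⟨α, rfl⟩ := S.toE0_surjective p (j + 1) z
  have h := (S.d0_toE0 l p (j + 1) α).symm.trans hz
  obtain ⟨η, hη⟩ := (S.mem_filtration_one_iff j _).1 ((S.toE0_eq_zero_iff hn (by omega) _).1 h)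
  refine ⟨α, ⟨η, S.L_injective hn (by omega) ?_⟩, rfl, hη.symm⟩
  rw [← S.d_L, hη, d_d, map_zero]

/-- Cancelling L in d_l (L ξ) = L η shows η = d_{l-1} ξ. Phrasing exactness through F^1 lets the
later chases treat j = 0, where both sides mean η = 0, together with j > 0. -/
theorem mem_coboundaries_iff_exists_filtration (hn : Module.finrank ℝ E = 2 * n)
    (l : ℤ) {j : ℕ} (hj : j + 1 ≤ n)
    (η : DiffForm E M j) : η ∈ coboundaries (S.d (l - 1)) j ↔
      ∃ f ∈ S.filtration 1 (j + 1), S.d l (j + 1) f = S.L j η := by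
  have hinj := S.L_injective hn hj
  match j, η with
  | 0, η =>
    constructor
    · intro h
      refine ⟨0, zero_mem _, ?_⟩
      rw [(Submodule.mem_bot ℝ).1 h, map_zero, map_zero]
    · rintro ⟨f, hf, h⟩
      rw [(Submodule.mem_bot ℝ).1 hf, map_zero] at h
      exact (Submodule.mem_bot ℝ).2 (hinj (h.symm.trans (map_zero _).symm))
  | j + 1, η =>
    constructor
    · rintro ⟨ξ, rfl⟩
      exact ⟨S.L j ξ, ⟨ξ, Submodule.mem_top, rfl⟩, S.d_L l j ξ⟩
    · rintro ⟨_, ⟨ξ, -, rfl⟩, h⟩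
      exact ⟨ξ, hinj ((S.d_L l j ξ).symm.trans h)⟩

/-- This makes δ well defined: if [L^p α] = [L^p d_l γ], then α - d_l γ lies in F^1 and still has
differential L η. -/
theorem mem_coboundaries_of_toE0 (hn : Module.finrank ℝ E = 2 * n)
    (l : ℤ) {p j : ℕ} (hp : p + j + 2 ≤ n) {α : DiffForm E M (j + 1)}
    {η : DiffForm E M j} (h : S.d l (j + 1) α = S.L j η)
    (hα : S.toE0 p (j + 1) α ∈ coboundaries (S.d0 (l + p) p) (p + (j + 1))) :
    η ∈ coboundaries (S.d (l - 1)) j := by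
  obtain ⟨_, ⟨γ, rfl⟩, hγ⟩ := (S.mem_coboundaries_E0_iff l p (j + 1) _).1 hα
  refine (S.mem_coboundaries_iff_exists_filtration hn l (by omega) η).2
    ⟨α - S.d l j γ, (S.toE0_eq_zero_iff hn (show j + 1 + p ≤ n by omega) _).1 ?_, ?_⟩
  · rw [map_sub, hγ, sub_self]
  · rw [map_sub, d_d, sub_zero, h]

/-- The triples (z, α, η) form a linear relation between classes, total by `exists_connecting_pair`
and single-valued by `mem_coboundaries_of_toE0`. Linearity of δ then needs no linear choice of α and
η. -/
theorem exists_isConnecting (hn : Module.finrank ℝ E = 2 * n)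
    (l : ℤ) {p j : ℕ} (hp : p + j + 2 ≤ n) :
    ∃ δ : S.E1 (l + p) p (p + (j + 1)) →ₗ[ℝ] S.H (l - 1) j, S.IsConnecting l p j δ := by
  let R : Submodule ℝ (S.E1 (l + p) p (p + (j + 1)) × S.H (l - 1) j) :=
    { carrier := {x | ∃ (z : LinearMap.ker (S.d0 (l + p) p (p + (j + 1))))
        (α : DiffForm E M (j + 1)) (η : LinearMap.ker (S.d (l - 1) j)),
        (z : S.E0 p (p + (j + 1))) = S.toE0 p (j + 1) α ∧ S.d l (j + 1) α = S.L j η ∧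
        Cohomology.mk (S.d0 (l + p) p) (p + (j + 1)) z = x.1 ∧
        Cohomology.mk (S.d (l - 1)) j η = x.2}
      add_mem' := by
        rintro x y ⟨z, α, η, h1, h2, h3, h4⟩ ⟨z', α', η', h1', h2', h3', h4'⟩
        refine ⟨z + z', α + α', η + η', ?_, ?_, ?_, ?_⟩
        · rw [Submodule.coe_add, h1, h1', map_add]
        · rw [Submodule.coe_add, map_add, h2, h2', map_add]
        · rw [map_add, h3, h3']; rfl
        · rw [map_add, h4, h4']; rfl
      zero_mem' := by
        refine ⟨0, 0, 0, ?_, ?_, map_zero _, map_zero _⟩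
        · exact (map_zero _).symm
        · rw [map_zero]; exact (map_zero _).symm
      smul_mem' := by
        rintro c x ⟨z, α, η, h1, h2, h3, h4⟩
        refine ⟨c • z, c • α, c • η, ?_, ?_, ?_, ?_⟩
        · rw [Submodule.coe_smul, h1, map_smul]
        · rw [Submodule.coe_smul, map_smul, h2, map_smul]
        · rw [map_smul, h3]; rfl
        · rw [map_smul, h4]; rfl }
  obtain ⟨δ, hδ⟩ := exists_linearMap_of_relation R (fun x => by
      obtain ⟨z, rfl⟩ := cohomologyMk_surjective _ _ x
      obtain ⟨α, η, h1, h2⟩ := S.exists_connecting_pair hn l hp z z.2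
      exact ⟨_, z, α, η, h1, h2, rfl, rfl⟩) (by
      rintro _ ⟨z, α, η, h1, h2, h3, rfl⟩
      refine (cohomologyMk_eq_zero_iff _ η).2 (S.mem_coboundaries_of_toE0 hn l hp h2 ?_)
      rw [← h1]
      exact (cohomologyMk_eq_zero_iff _ z).1 h3)
  exact ⟨δ, fun z => ⟨S.exists_connecting_pair hn l hp z z.2,
    fun α η h1 h2 => hδ _ _ ⟨z, α, η, h1, h2, rfl, rfl⟩⟩⟩

variable {S} in
-- If [η] = 0, then L η = d_l f with f in F^1, and α - f is a closed form with the same image in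
-- E_0. Conversely a closed β allows the choice η = 0.
theorem IsConnecting.exact_left (hn : Module.finrank ℝ E = 2 * n)
    {l : ℤ} {p j : ℕ} (hp : p + j + 2 ≤ n)
    {δ : S.E1 (l + p) p (p + (j + 1)) →ₗ[ℝ] S.H (l - 1) j} (hδ : S.IsConnecting l p j δ) :
    Function.Exact (S.LbarP l p (j + 1)) δ := by
  intro x
  constructor
  · intro hx
    obtain ⟨z, rfl⟩ := cohomologyMk_surjective _ _ x
    obtain ⟨⟨α, η, h1, h2⟩, h3⟩ := hδ z
    rw [h3 α η h1 h2, cohomologyMk_eq_zero_iff,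
      S.mem_coboundaries_iff_exists_filtration hn l (by omega)] at hx
    obtain ⟨f, hf, hdf⟩ := hx
    refine ⟨Cohomology.mk (S.d l) (j + 1) ⟨α - f, ?_⟩, ?_⟩
    · rw [LinearMap.mem_ker, map_sub, h2, hdf, sub_self]
    · refine congrArg (Cohomology.mk (S.d0 (l + p) p) (p + (j + 1))) (Subtype.ext ?_)
      exact (by rw [map_sub, S.toE0_eq_zero hf, sub_zero] :
        S.toE0 p (j + 1) (α - f) = S.toE0 p (j + 1) α).trans h1.symm
  · rintro ⟨y, rfl⟩
    obtain ⟨β, rfl⟩ := cohomologyMk_surjective _ _ y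
    refine ((hδ _).2 β 0 rfl ?_).trans (map_zero _)
    exact (LinearMap.mem_ker.1 β.2).trans (map_zero (S.L j)).symm

/-- If L^p β is a coboundary in E_0, then β - d_l γ = L η, with η closed by injectivity of L.
Cocycles of E_0^{p,p+j+2} are never lifted, so the last case p + j + 2 = n is included. -/
theorem Lbar_LbarP_exact (hn : Module.finrank ℝ E = 2 * n) (l : ℤ) {p j : ℕ} (hp : p + j + 2 ≤ n) :
    Function.Exact (S.Lbar l j) (S.LbarP l p (j + 2)) := by
  intro x
  constructor
  · intro hx
    obtain ⟨β, rfl⟩ := cohomologyMk_surjective _ _ x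
    have h := (cohomologyMk_eq_zero_iff (S.d0 (l + p) p) (j := p + (j + 2)) _).1 hx
    obtain ⟨_, ⟨γ, rfl⟩, hγ⟩ := (S.mem_coboundaries_E0_iff l p (j + 2) _).1 h
    have h1 : S.toE0 p (j + 2) (β - S.d l (j + 1) γ) = 0 := by
      rw [map_sub, hγ]; exact sub_self _
    obtain ⟨η, hη⟩ := (S.mem_filtration_one_iff j _).1 ((S.toE0_eq_zero_iff hn (by omega) _).1 h1)
    have hdη : S.d (l - 1) j η = 0 := S.L_injective hn (by omega) (by
      rw [← S.d_L, hη, map_sub, d_d, LinearMap.mem_ker.1 β.2, sub_zero, map_zero])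
    refine ⟨Cohomology.mk _ _ ⟨η, hdη⟩, ?_⟩
    rw [← sub_eq_zero]
    refine (cohomologyMk_eq_zero_iff (S.d l) (j := j + 2) (⟨S.L j η, _⟩ - β)).2 ⟨-γ, ?_⟩
    have : S.d l (j + 1) (-γ) = S.L j η - β := by
      rw [map_neg, hη]
      abel
    exact this
  · rintro ⟨y, rfl⟩
    obtain ⟨η, rfl⟩ := cohomologyMk_surjective _ _ y
    refine (cohomologyMk_eq_zero_iff (S.d0 (l + p) p) (j := p + (j + 2)) ⟨S.toE0 p (j + 2) _, _⟩).2 ?_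
    have : S.toE0 p (j + 2) (S.L j η) = 0 :=
      S.toE0_eq_zero ((S.mem_filtration_one_iff j _).2 ⟨η, rfl⟩)
    have h0 : S.toE0 p (j + 2) (S.L j η) ∈ coboundaries (S.d0 (l + p) p) (p + (j + 2)) := by
      rw [this]
      exact zero_mem _
    exact h0
end LCS.LCSStructure

theorem theorem4p4 (n : ℕ) (M : Type*) [TopologicalSpace M]
    [ChartedSpace (EuclideanSpace ℝ (Fin (2 * n))) M]
    [IsManifold 𝓘(ℝ, EuclideanSpace ℝ (Fin (2 * n))) ∞ M]
    (S : LCSStructure (EuclideanSpace ℝ (Fin (2 * n))) M) (l : ℤ) :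
    (∀ k ≤ n, IsCompl (S.primitive n k) (S.filtration 1 k)) ∧
    (∀ p j : ℕ, p + j + 1 ≤ n →
      ∃ Φ : Cohomology (S.dplus n l) j ≃ₗ[ℝ] S.E1 (l + p) p (p + j),
        ∀ a : LinearMap.ker (S.dplus n l j),
          ∃ z : LinearMap.ker (S.d0 (l + p) p (p + j)),
            (z : S.E0 p (p + j)) = S.toE0 p j a ∧
            Φ (Cohomology.mk (S.dplus n l) j a) = Cohomology.mk (S.d0 (l + p) p) (p + j) z) ∧
    (∀ p : ℕ, p + 1 ≤ n →
      Function.Bijective (S.LbarP l p 0) ∧ Function.Injective (S.LbarP l p 1)) ∧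
    (∀ p j : ℕ, p + j + 2 ≤ n →
      ∃ δ : S.E1 (l + p) p (p + (j + 1)) →ₗ[ℝ] S.H (l - 1) j,
        S.IsConnecting l p j δ ∧
        Function.Exact (S.LbarP l p (j + 1)) δ ∧
        Function.Exact δ (S.Lbar l j) ∧
        Function.Exact (S.Lbar l j) (S.LbarP l p (j + 2))) := by
  have hn : Module.finrank ℝ (EuclideanSpace ℝ (Fin (2 * n))) = 2 * n := by simp
  refine ⟨fun k hk => S.isCompl_primitive hn hk,
    fun p j hp => S.exists_primitive_equiv hn l hp,
    fun p hp => ⟨S.LbarP_zero_bijective hn l hp, S.LbarP_one_injective hn l hp⟩,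
    fun p j hp => ?_⟩
  obtain ⟨δ, hδ⟩ := S.exists_isConnecting hn l hp
  exact ⟨δ, hδ, hδ.exact_left hn hp, hδ.exact_right, S.Lbar_LbarP_exact hn l hp⟩
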